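/- **Conventions.** A (small) non-symmetric operad (multicategory) $\mathcal P$ consists of a set of objects, sets $\mathcal P(p_1,\dots,p_n;p_0)$ for all $n\ge 0$ and objects $p_0,\dots,p_n$, identities $\mathrm{id}_p\in\mathcal P(p;p)$, and associative and unital compositions $\psi\circ(\psi_1,\dots,\psi_n)$. A symmetric operad has in addition actions $\sigma^*:\mathcal P(p_1,\dots,p_n;p_0)\to\mathcal P(p_{\sigma(1)},\dots,p_{\sigma(n)};p_0)$ of the symmetric groups, compatible with composition. Functors of (symmetric) operads preserve all the structure; this gives the categories $\mathbf{Ope}$ and $\mathbf{Ope}_\Sigma$. The functor $j_!$ from the category $\mathbf{Cat}$ of small categories to $\mathbf{Ope}$, respectively to $\mathbf{Ope}_\Sigma$, regards a category as an operad with only unary morphisms. Its right adjoint $j^*$ sends an operad to its underlying category of unary morphisms. A Quillen model structure on a category is a choice of three classes of morphisms (weak equivalences, fibrations, cofibrations) such that the category is small complete and small cocomplete and the three-for-two, retract, lifting and factorization axioms hold. An adjunction $L\dashv R$ between categories with Quillen model structures is a Quillen adjunction if $L$ preserves cofibrations and trivial cofibrations (cofibrations that are weak equivalences). On $\mathbf{Cat}$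 (Rezk model structure), the weak equivalences are the equivalences of categories, the cofibrations are the functors injective on objects, and the fibrations are the functors $F:\mathcal C\to\mathcal D$ such that each isomorphism $\psi:Fc\to d$ in $\mathcal D$ is $F\phi$ for an isomorphism $\phi:c\to c'$ in $\mathcal C$. On $\mathbf{Ope}$ and on $\mathbf{Ope}_\Sigma$, the weak equivalences are the functors $F:\mathcal P\to\mathcal Q$ such that $j^*F$ is essentially surjective and all maps $\mathcal P(p_1,\dots,p_n;p_0)\to\mathcal Q(Fp_1,\dots,Fp_n;Fp_0)$ are bijective; the cofibrations are the functors injective on objects; and the fibrations are the functors $F:\mathcal P\to\mathcal Q$ such that each isomorphism $\psi:Fp\to q$ of $\mathcal Q$ (that is, of $j^*\mathcal Q$) is $F\phi$ for an isomorphism $\phi:p\to p'$ of $\mathcal P$. **Lemma.** With these classes, $\mathbf{Cat}$, $\mathbf{Ope}$ and $\mathbf{Ope}_\Sigma$ carry Quillen model structures, and the adjunctions $j_!\dashv j^*$ between $\mathbf{Cat}$ and $\mathbf{Ope}$ and between $\mathbf{Cat}$ and $\mathbf{Ope}_\Sigma$ are Quillen adjunctions. Moreover, in both cases, both functors $j_!$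 and $j^*$ preserve cofibrations, fibrations and weak equivalences. -/

import Mathlib

open CategoryTheory CategoryTheory.Limits

universe u

/-! ## Quillen model structures and Quillen adjunctions -/

/-- A specification of three classes of morphisms in a category. -/
structure ModelClasses (C : Type*) [Category C] where
  weq : MorphismProperty C
  fib : MorphismProperty C
  cof : MorphismProperty C

/-- The three classes form a Quillen model structure: the category is small complete and small
cocomplete, and the three for two, retract, lifting and factorization axioms hold. -/
structure ModelClasses.IsModelStructure {C : Type*} [Category C] (M : ModelClasses C) : Prop where
  hasLimits : HasLimits C
  hasColimits : HasColimits C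
  weq_twoOutOfThree : M.weq.HasTwoOutOfThreeProperty
  weq_retracts : M.weq.IsStableUnderRetracts
  fib_retracts : M.fib.IsStableUnderRetracts
  cof_retracts : M.cof.IsStableUnderRetracts
  lifting : ∀ {A B X Y : C} (i : A ⟶ B) (p : X ⟶ Y), M.cof i → M.fib p →
    (M.weq i ∨ M.weq p) → HasLiftingProperty i p
  factorization_cof_trivialFib : MorphismProperty.HasFactorization M.cof (M.fib ⊓ M.weq)
  factorization_trivialCof_fib : MorphismProperty.HasFactorization (M.cof ⊓ M.weq) M.fib

/-- An adjunction `L ⊣ R` between two model categories is a Quillen adjunction if the left adjoint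
preserves cofibrations and trivial cofibrations. -/
structure IsQuillenAdjunction {C D : Type*} [Category C] [Category D]
    (M : ModelClasses C) (N : ModelClasses D) {L : C ⥤ D} {R : D ⥤ C} (_adj : L ⊣ R) : Prop where
  isModelStructure_source : M.IsModelStructure
  isModelStructure_target : N.IsModelStructure
  map_cof : ∀ {X Y : C} (f : X ⟶ Y), M.cof f → N.cof (L.map f)
  map_trivialCof : ∀ {X Y : C} (f : X ⟶ Y), (M.cof ⊓ M.weq) f → (N.cof ⊓ N.weq) (L.map f)

/-- The functor preserves cofibrations, fibrations and weak equivalences. -/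
structure PreservesModelClasses {C D : Type*} [Category C] [Category D]
    (M : ModelClasses C) (N : ModelClasses D) (F : C ⥤ D) : Prop where
  map_cof : ∀ {X Y : C} (f : X ⟶ Y), M.cof f → N.cof (F.map f)
  map_fib : ∀ {X Y : C} (f : X ⟶ Y), M.fib f → N.fib (F.map f)
  map_weq : ∀ {X Y : C} (f : X ⟶ Y), M.weq f → N.weq (F.map f)

/-! ## Operads -/

/-- The concatenation of the finite sequences `w 0, w 1, …, w (n - 1)`, where `w i` has
length `k i`. -/
def concatSeq {O : Type*} {n : ℕ} {k : Fin n → ℕ} (w : ∀ i, Fin (k i) → O) :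
    Fin (∑ i, k i) → O :=
  fun a => w (finSigmaFinEquiv.symm a).1 (finSigmaFinEquiv.symm a).2

/-- A (small) non-symmetric operad, also known as a multicategory. A sequence `p₁, …, pₙ` of
objects is a function `Fin n → Ob`. The axioms are equalities between morphisms whose sequences of
inputs agree only propositionally; they are therefore stated in the type of all triples
(arity, sequence of inputs, morphism) with a given output. -/
structure Operad : Type (u + 1) where
  Ob : Type u
  Hom : ∀ {n : ℕ}, (Fin n → Ob) → Ob → Type u
  id : ∀ p : Ob, Hom (fun _ : Fin 1 => p) p
  comp : ∀ {n : ℕ} {x : Fin n → Ob} {y : Ob} {k : Fin n → ℕ} {w : ∀ i, Fin (k i) → Ob},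
    Hom x y → (∀ i, Hom (w i) (x i)) → Hom (concatSeq w) y
  id_comp : ∀ {n : ℕ} {x : Fin n → Ob} {y : Ob} (ψ : Hom x y),
    (⟨_, _, comp (id y) (fun _ => ψ)⟩ : Σ (m : ℕ) (z : Fin m → Ob), Hom z y) = ⟨n, x, ψ⟩
  comp_id : ∀ {n : ℕ} {x : Fin n → Ob} {y : Ob} (ψ : Hom x y),
    (⟨_, _, comp ψ (fun i => id (x i))⟩ : Σ (m : ℕ) (z : Fin m → Ob), Hom z y) = ⟨n, x, ψ⟩
  assoc : ∀ {n : ℕ} {x : Fin n → Ob} {y : Ob} {k : Fin n → ℕ} {w : ∀ i, Fin (k i) → Ob}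
    {l : ∀ i, Fin (k i) → ℕ} {v : ∀ i j, Fin (l i j) → Ob}
    (ψ : Hom x y) (φ : ∀ i, Hom (w i) (x i)) (χ : ∀ i j, Hom (v i j) (w i j)),
    (⟨_, _, comp (comp ψ φ) (fun a => χ (finSigmaFinEquiv.symm a).1 (finSigmaFinEquiv.symm a).2)⟩ :
      Σ (m : ℕ) (z : Fin m → Ob), Hom z y) =
    ⟨_, _, comp ψ (fun i => comp (φ i) (χ i))⟩

/-- The bijection between concatenated index sets that permutes the blocks by `σ` and is `τ j`
between the block `j` and the block `σ j`. -/
def blockPerm {m n : ℕ} {k' : Fin m → ℕ} {k : Fin n → ℕ} (σ : Fin m ≃ Fin n)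
    (τ : ∀ j, Fin (k' j) ≃ Fin (k (σ j))) : Fin (∑ j, k' j) ≃ Fin (∑ i, k i) :=
  finSigmaFinEquiv.symm.trans ((Equiv.sigmaCongr σ τ).trans finSigmaFinEquiv)

/-- A (small) symmetric operad: an operad with right actions
`σ^* : P(p₁, …, pₙ; p) → P(p_{σ 1}, …, p_{σ n}; p)` of the symmetric groups, compatible with
composition. A permutation is given as a bijection `Fin m ≃ Fin n`; this forces `m = n`, so the data
and the laws are those for permutations of `Fin n`. The axiom `comp_act` contains both usual
equivariance axioms: permuting the inputs of the outer morphism (all `τ j` identities) and of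
the inner morphisms (`σ` the identity). -/
structure SymmOperad : Type (u + 1) extends Operad.{u} where
  act : ∀ {m n : ℕ} {x : Fin n → Ob} {y : Ob} (σ : Fin m ≃ Fin n), Hom x y → Hom (x ∘ σ) y
  act_refl : ∀ {n : ℕ} {x : Fin n → Ob} {y : Ob} (ψ : Hom x y), act (Equiv.refl (Fin n)) ψ = ψ
  act_trans : ∀ {l m n : ℕ} {x : Fin n → Ob} {y : Ob} (σ : Fin m ≃ Fin n) (τ : Fin l ≃ Fin m)
    (ψ : Hom x y), act (τ.trans σ) ψ = act τ (act σ ψ)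
  comp_act : ∀ {m n : ℕ} {x : Fin n → Ob} {y : Ob} {k' : Fin m → ℕ} {k : Fin n → ℕ}
    {w : ∀ i, Fin (k i) → Ob} (σ : Fin m ≃ Fin n) (τ : ∀ j, Fin (k' j) ≃ Fin (k (σ j)))
    (ψ : Hom x y) (φ : ∀ i, Hom (w i) (x i)),
    (⟨_, _, comp (act σ ψ) (fun j => act (τ j) (φ (σ j)))⟩ :
      Σ (m : ℕ) (z : Fin m → Ob), Hom z y) =
    ⟨_, _, act (blockPerm σ τ) (comp ψ φ)⟩

/-- A functor between operads. -/
@[ext]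
structure OperadFunctor (P Q : Operad.{u}) where
  obj : P.Ob → Q.Ob
  map : ∀ {n : ℕ} {x : Fin n → P.Ob} {y : P.Ob}, P.Hom x y → Q.Hom (obj ∘ x) (obj y)
  map_id : ∀ p, map (P.id p) = Q.id (obj p)
  map_comp : ∀ {n : ℕ} {x : Fin n → P.Ob} {y : P.Ob} {k : Fin n → ℕ} {w : ∀ i, Fin (k i) → P.Ob}
    (ψ : P.Hom x y) (φ : ∀ i, P.Hom (w i) (x i)),
    map (P.comp ψ φ) = Q.comp (w := fun i => obj ∘ w i) (map ψ) (fun i => map (φ i))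

/-- A functor between symmetric operads. -/
@[ext]
structure SymmOperadFunctor (P Q : SymmOperad.{u}) extends
    OperadFunctor P.toOperad Q.toOperad where
  map_act : ∀ {m n : ℕ} {x : Fin n → P.Ob} {y : P.Ob} (σ : Fin m ≃ Fin n) (ψ : P.Hom x y),
    map (P.act σ ψ) = Q.act σ (map ψ)

/-- The identity functor of an operad. -/
def OperadFunctor.id (P : Operad.{u}) : OperadFunctor P P where
  obj p := p
  map ψ := ψ
  map_id _ := rfl
  map_comp _ _ := rfl

/-- The composition of functors between operads. -/
def OperadFunctor.comp {P Q R : Operad.{u}} (F : OperadFunctor P Q) (G : OperadFunctor Q R) :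
    OperadFunctor P R where
  obj p := G.obj (F.obj p)
  map ψ := G.map (F.map ψ)
  map_id p := by rw [F.map_id]; exact G.map_id _
  map_comp ψ φ := by rw [F.map_comp]; exact G.map_comp _ _

/-- The category `Ope` of (small) operads. -/
instance : Category Operad.{u} where
  Hom P Q := OperadFunctor P Q
  id P := OperadFunctor.id P
  comp F G := OperadFunctor.comp F G

/-- The category `Ope_Σ` of (small) symmetric operads. -/
instance : Category SymmOperad.{u} where
  Hom P Q := SymmOperadFunctor P Q
  id P :=
    { toOperadFunctor := OperadFunctor.id P.toOperad
      map_act := fun _ _ => rfl }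
  comp {P Q R} F G :=
    { toOperadFunctor := OperadFunctor.comp F.toOperadFunctor G.toOperadFunctor
      map_act := fun σ ψ =>
        (congrArg G.map (F.map_act σ ψ)).trans (G.map_act σ (F.map ψ)) }

/-- The functor forgetting the actions of the symmetric groups. -/
def SymmOperad.forget : SymmOperad.{u} ⥤ Operad.{u} where
  obj P := P.toOperad
  map F := SymmOperadFunctor.toOperadFunctor F

/-! ## The underlying category of an operad -/

namespace Operad

/-- All morphisms with output `y`, with any sequence of inputs. -/
abbrev Arr (P : Operad.{u}) (y : P.Ob) : Type u := Σ (n : ℕ) (x : Fin n → P.Ob), P.Hom x y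

/-- Transport of a morphism along an equality between its sequence of inputs and another one. -/
def recast (P : Operad.{u}) {m n : ℕ} {x : Fin m → P.Ob} {x' : Fin n → P.Ob} {y : P.Ob}
    (h : n = m) (hx : ∀ i, x (Fin.cast h i) = x' i) (ψ : P.Hom x y) : P.Hom x' y :=
  cast (by subst h; obtain rfl : x = x' := funext hx; rfl) ψ

theorem mk_recast (P : Operad.{u}) {m n : ℕ} {x : Fin m → P.Ob} {x' : Fin n → P.Ob} {y : P.Ob}
    (h : n = m) (hx : ∀ i, x (Fin.cast h i) = x' i) (ψ : P.Hom x y) :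
    (⟨n, x', P.recast h hx ψ⟩ : P.Arr y) = ⟨m, x, ψ⟩ := by
  subst h; obtain rfl : x = x' := funext hx; rfl

theorem eq_of_mk_eq (P : Operad.{u}) {n : ℕ} {x : Fin n → P.Ob} {y : P.Ob} {ψ φ : P.Hom x y}
    (h : (⟨n, x, ψ⟩ : P.Arr y) = ⟨n, x, φ⟩) : ψ = φ := by
  simpa using h

theorem mk_comp_congr (P : Operad.{u}) {n : ℕ} {x : Fin n → P.Ob} {y : P.Ob} (ψ : P.Hom x y)
    {k k' : Fin n → ℕ} {w : ∀ i, Fin (k i) → P.Ob} {w' : ∀ i, Fin (k' i) → P.Ob}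
    (φ : ∀ i, P.Hom (w i) (x i)) (φ' : ∀ i, P.Hom (w' i) (x i))
    (h : ∀ i, (⟨_, _, φ i⟩ : P.Arr (x i)) = ⟨_, _, φ' i⟩) :
    (⟨_, _, P.comp ψ φ⟩ : P.Arr y) = ⟨_, _, P.comp ψ φ'⟩ :=
  congrArg (fun A : ∀ i, P.Arr (x i) => (⟨_, _, P.comp ψ (fun i => (A i).2.2)⟩ : P.Arr y))
    (funext h)

theorem mk_comp_recast (P : Operad.{u}) {m n : ℕ} {x : Fin m → P.Ob} {x' : Fin n → P.Ob}
    {y : P.Ob} (h : n = m) (hx : ∀ i, x (Fin.cast h i) = x' i) (ψ : P.Hom x y)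
    {k : Fin n → ℕ} {w : ∀ i, Fin (k i) → P.Ob} (φ : ∀ i, P.Hom (w i) (x' i))
    {k' : Fin m → ℕ} {w' : ∀ i, Fin (k' i) → P.Ob} (φ' : ∀ i, P.Hom (w' i) (x i))
    (hφ : ∀ i, HEq (⟨_, _, φ' (Fin.cast h i)⟩ : P.Arr (x (Fin.cast h i)))
      (⟨_, _, φ i⟩ : P.Arr (x' i))) :
    (⟨_, _, P.comp (P.recast h hx ψ) φ⟩ : P.Arr y) = ⟨_, _, P.comp ψ φ'⟩ := by
  subst h; obtain rfl : x = x' := funext hx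
  exact P.mk_comp_congr ψ φ φ' fun i => (eq_of_heq (hφ i)).symm

/-- The composition of unary morphisms. -/
def unaryComp (P : Operad.{u}) {a b c : P.Ob} (f : P.Hom (fun _ : Fin 1 => a) b)
    (g : P.Hom (fun _ : Fin 1 => b) c) : P.Hom (fun _ : Fin 1 => a) c :=
  P.recast (by simp) (fun _ => rfl) (P.comp g (fun _ => f))

theorem mk_unaryComp (P : Operad.{u}) {a b c : P.Ob} (f : P.Hom (fun _ : Fin 1 => a) b)
    (g : P.Hom (fun _ : Fin 1 => b) c) :
    (⟨_, _, P.unaryComp f g⟩ : P.Arr c) = ⟨_, _, P.comp g (fun _ => f)⟩ :=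
  P.mk_recast _ _ _

/-- The underlying category of an operad, obtained by neglecting the non-unary morphisms. -/
structure Underlying (P : Operad.{u}) : Type u where
  ob : P.Ob

instance (P : Operad.{u}) : Category.{u} P.Underlying where
  Hom a b := P.Hom (fun _ : Fin 1 => a.ob) b.ob
  id a := P.id a.ob
  comp f g := P.unaryComp f g
  id_comp f := P.eq_of_mk_eq ((P.mk_unaryComp _ _).trans (P.comp_id f))
  comp_id f := P.eq_of_mk_eq ((P.mk_unaryComp _ _).trans (P.id_comp f))
  assoc f g h := by
    apply P.eq_of_mk_eq
    rw [mk_unaryComp, mk_unaryComp]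
    refine (P.mk_comp_congr h _ (fun _ => P.comp g (fun _ => f))
      fun _ => P.mk_unaryComp _ _).trans ?_
    refine (P.assoc h (fun _ => g) (fun _ _ => f)).symm.trans ?_
    refine (P.mk_comp_recast _ _ _ _ _ ?_).symm
    intro i
    rfl

end Operad

theorem OperadFunctor.map_recast {P Q : Operad.{u}} (F : OperadFunctor P Q) {m n : ℕ}
    {x : Fin m → P.Ob} {x' : Fin n → P.Ob} {y : P.Ob}
    (h : n = m) (hx : ∀ i, x (Fin.cast h i) = x' i) (ψ : P.Hom x y) :
    F.map (P.recast h hx ψ) = Q.recast h (fun i => congrArg F.obj (hx i)) (F.map ψ) := by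
  subst h; obtain rfl : x = x' := funext hx; rfl

/-- The functor between underlying categories induced by a functor between operads. -/
def OperadFunctor.underlying {P Q : Operad.{u}} (F : OperadFunctor P Q) :
    P.Underlying ⥤ Q.Underlying where
  obj a := ⟨F.obj a.ob⟩
  map f := F.map f
  map_id a := F.map_id a.ob
  map_comp f g := by
    refine (F.map_recast (x' := fun _ : Fin 1 => _) (by simp) (fun _ => rfl) (P.comp g (fun _ => f))).trans ?_
    rw [F.map_comp]
    rfl

/-- The functor `j^* : Ope ⥤ Cat`. -/
def jStar : Operad.{u} ⥤ Cat.{u, u} where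
  obj P := Cat.of P.Underlying
  map F := (OperadFunctor.underlying F).toCatHom

/-- The functor `j^* : Ope_Σ ⥤ Cat`. -/
def jStarSymm : SymmOperad.{u} ⥤ Cat.{u, u} :=
  SymmOperad.forget ⋙ jStar

/-! ## The operad of a category -/

/-- A morphism from a sequence `x` to `y` in the operad associated with a category: there is none
unless the sequence has length one, and then it is a morphism in the category from the only entry
of `x` to `y` (written as a family indexed by the one-element index set). -/
@[ext]
structure UnaryHom {C : Type u} [Category.{u} C] {n : ℕ} (x : Fin n → C) (y : C) : Type u where
  arity : n = 1
  hom : ∀ i : Fin n, x i ⟶ y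

section UnaryHom

variable {C : Type u} [Category.{u} C]

theorem UnaryHom.mk_eq {m n : ℕ} {x : Fin m → C} {x' : Fin n → C} {y : C}
    (f : UnaryHom x y) (f' : UnaryHom x' y) (i : Fin m) (j : Fin n)
    (h : (⟨x i, f.hom i⟩ : Σ c : C, c ⟶ y) = ⟨x' j, f'.hom j⟩) :
    (⟨m, x, f⟩ : Σ (n : ℕ) (z : Fin n → C), UnaryHom z y) = ⟨n, x', f'⟩ := by
  obtain ⟨rfl, f⟩ := f
  obtain ⟨rfl, f'⟩ := f'
  obtain rfl : i = 0 := Subsingleton.elim _ _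
  obtain rfl : j = 0 := Subsingleton.elim _ _
  have h1 : x 0 = x' 0 := congrArg Sigma.fst h
  obtain rfl : x = x' := funext fun i => by
    obtain rfl : i = 0 := Subsingleton.elim _ _
    exact h1
  have h2 : f 0 = f' 0 := by simpa using h
  obtain rfl : f = f' := funext fun i => by
    obtain rfl : i = 0 := Subsingleton.elim _ _
    exact h2
  rfl

/-- The unique index of the only input of a morphism. -/
def UnaryHom.idx {n : ℕ} {x : Fin n → C} {y : C} (f : UnaryHom x y) : Fin n :=
  Fin.cast f.arity.symm 0

/-- The composition in the operad associated with a category. -/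
def UnaryHom.comp {n : ℕ} {x : Fin n → C} {y : C} {k : Fin n → ℕ} {w : ∀ i, Fin (k i) → C}
    (g : UnaryHom x y) (f : ∀ i, UnaryHom (w i) (x i)) : UnaryHom (concatSeq w) y where
  arity := by
    obtain ⟨rfl, _⟩ := g
    simpa using (f 0).arity
  hom a := (f (finSigmaFinEquiv.symm a).1).hom (finSigmaFinEquiv.symm a).2 ≫
    g.hom (finSigmaFinEquiv.symm a).1

theorem UnaryHom.mk_comp_hom {n : ℕ} {x : Fin n → C} {y : C} {k : Fin n → ℕ}
    {w : ∀ i, Fin (k i) → C} (g : UnaryHom x y) (f : ∀ i, UnaryHom (w i) (x i))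
    (i : Fin n) (j : Fin (k i)) :
    (⟨_, (UnaryHom.comp g f).hom (finSigmaFinEquiv ⟨i, j⟩)⟩ : Σ c : C, c ⟶ y) =
      ⟨w i j, (f i).hom j ≫ g.hom i⟩ :=
  congrArg (fun t : Σ i, Fin (k i) =>
    (⟨w t.1 t.2, (f t.1).hom t.2 ≫ g.hom t.1⟩ : Σ c : C, c ⟶ y))
    (finSigmaFinEquiv.symm_apply_apply ⟨i, j⟩)

/-- The action of a bijection on morphisms in the operad associated with a category. -/
def UnaryHom.act {m n : ℕ} {x : Fin n → C} {y : C} (σ : Fin m ≃ Fin n) (ψ : UnaryHom x y) :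
    UnaryHom (x ∘ σ) y where
  arity := (show m = n by simpa using Fintype.card_congr σ).trans ψ.arity
  hom i := ψ.hom (σ i)

theorem UnaryHom.mk_comp_act {m n : ℕ} {x : Fin n → C} {y : C} {k' : Fin m → ℕ} {k : Fin n → ℕ}
    {w : ∀ i, Fin (k i) → C} (σ : Fin m ≃ Fin n) (τ : ∀ j, Fin (k' j) ≃ Fin (k (σ j)))
    (ψ : UnaryHom x y) (φ : ∀ i, UnaryHom (w i) (x i)) :
    (⟨_, _, UnaryHom.comp (ψ.act σ) (fun j => (φ (σ j)).act (τ j))⟩ :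
      Σ (m : ℕ) (z : Fin m → C), UnaryHom z y) =
    ⟨_, _, (UnaryHom.comp ψ φ).act (blockPerm σ τ)⟩ := by
  let j := σ.symm ψ.idx
  let c := (τ j).symm (φ (σ j)).idx
  refine UnaryHom.mk_eq _ _ (finSigmaFinEquiv ⟨j, c⟩) (finSigmaFinEquiv ⟨j, c⟩) ?_
  refine (UnaryHom.mk_comp_hom _ _ _ _).trans ?_
  have h : blockPerm σ τ (finSigmaFinEquiv ⟨j, c⟩) = finSigmaFinEquiv ⟨σ j, τ j c⟩ := by
    simp [blockPerm, Equiv.sigmaCongr]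
  refine Eq.trans ?_ (congrArg (fun t =>
    (⟨_, (UnaryHom.comp ψ φ).hom t⟩ : Σ d : C, d ⟶ y)) h).symm
  exact (UnaryHom.mk_comp_hom ψ φ (σ j) (τ j c)).symm

end UnaryHom

/-- The operad `j_!(C)` associated with a category `C`. -/
def Operad.ofCat (C : Type u) [Category.{u} C] : Operad.{u} where
  Ob := C
  Hom x y := UnaryHom x y
  id p := ⟨rfl, fun _ => 𝟙 p⟩
  comp g f := UnaryHom.comp g f
  id_comp ψ := by
    refine UnaryHom.mk_eq _ _ (finSigmaFinEquiv ⟨(0 : Fin 1), ψ.idx⟩) ψ.idx ?_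
    refine (UnaryHom.mk_comp_hom _ _ _ _).trans ?_
    simp
  comp_id ψ := by
    refine UnaryHom.mk_eq _ _ (finSigmaFinEquiv ⟨ψ.idx, (0 : Fin 1)⟩) ψ.idx ?_
    refine (UnaryHom.mk_comp_hom _ _ _ _).trans ?_
    simp
  assoc {_ x y _ _ _ _} ψ φ χ := by
    let a := (UnaryHom.comp ψ φ).idx
    let s := finSigmaFinEquiv.symm a
    let c := (χ s.1 s.2).idx
    refine UnaryHom.mk_eq _ _ (finSigmaFinEquiv ⟨a, c⟩)
      (finSigmaFinEquiv ⟨s.1, finSigmaFinEquiv ⟨s.2, c⟩⟩) ?_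
    refine (UnaryHom.mk_comp_hom _ _ _ _).trans ?_
    refine Eq.trans ?_ (UnaryHom.mk_comp_hom _ _ _ _).symm
    refine Eq.trans ?_ (congrArg (fun t : Σ d : C, d ⟶ x s.1 =>
      (⟨t.1, t.2 ≫ ψ.hom s.1⟩ : Σ d : C, d ⟶ y)) (UnaryHom.mk_comp_hom _ _ _ _)).symm
    change (⟨_, _ ≫ _ ≫ _⟩ : Σ d : C, d ⟶ y) = _
    simp only [Category.assoc]
    rfl

/-- The symmetric operad `j_!(C)` associated with a category `C`. -/
def SymmOperad.ofCat (C : Type u) [Category.{u} C] : SymmOperad.{u} where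
  toOperad := Operad.ofCat C
  act σ ψ := UnaryHom.act σ ψ
  act_refl _ := rfl
  act_trans _ _ _ := rfl
  comp_act σ τ ψ φ := UnaryHom.mk_comp_act σ τ ψ φ

/-- The functor between operads induced by a functor between categories. -/
def OperadFunctor.ofFunctor {C D : Type u} [Category.{u} C] [Category.{u} D] (F : C ⥤ D) :
    OperadFunctor (Operad.ofCat C) (Operad.ofCat D) where
  obj c := F.obj c
  map ψ := ⟨UnaryHom.arity ψ, fun i => F.map (UnaryHom.hom ψ i)⟩
  map_id p := UnaryHom.ext (funext fun _ => F.map_id p)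
  map_comp _ _ := UnaryHom.ext (funext fun _ => F.map_comp _ _)

/-- The functor `j_! : Cat ⥤ Ope`. -/
def jShriek : Cat.{u, u} ⥤ Operad.{u} where
  obj C := Operad.ofCat C
  map F := OperadFunctor.ofFunctor F.toFunctor

/-- The functor `j_! : Cat ⥤ Ope_Σ`. -/
def jShriekSymm : Cat.{u, u} ⥤ SymmOperad.{u} where
  obj C := SymmOperad.ofCat C
  map F :=
    { toOperadFunctor := OperadFunctor.ofFunctor F.toFunctor
      map_act := fun _ _ => rfl }

/-! ## The adjunctions -/

section Adjunction

variable {C : Type u} [Category.{u} C]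

/-- The functor into the underlying category of an operad that corresponds to a functor between
operads. -/
def OperadFunctor.toUnderlying {P : Operad.{u}} (G : OperadFunctor (Operad.ofCat C) P) :
    C ⥤ P.Underlying where
  obj c := ⟨G.obj c⟩
  map {a b} f := G.map (x := fun _ : Fin 1 => (a : C)) (y := (b : C))
    (⟨rfl, fun _ => f⟩ : UnaryHom (fun _ : Fin 1 => a) b)
  map_id c := G.map_id c
  map_comp {a b c} f g := by
    have h : (⟨rfl, fun _ => f ≫ g⟩ : UnaryHom (fun _ : Fin 1 => a) c) =
        (Operad.ofCat C).unaryComp (a := a) (b := b) (c := c)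
          (⟨rfl, fun _ => f⟩ : UnaryHom (fun _ : Fin 1 => a) b)
          (⟨rfl, fun _ => g⟩ : UnaryHom (fun _ : Fin 1 => b) c) := by
      apply (Operad.ofCat C).eq_of_mk_eq
      refine Eq.trans ?_ ((Operad.ofCat C).mk_unaryComp _ _).symm
      refine UnaryHom.mk_eq _ _ (0 : Fin 1) (finSigmaFinEquiv ⟨(0 : Fin 1), (0 : Fin 1)⟩) ?_
      exact (UnaryHom.mk_comp_hom (C := C) (n := 1) (k := fun _ => 1)
        (⟨rfl, fun _ => g⟩ : UnaryHom (fun _ : Fin 1 => b) c)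
        (fun _ => (⟨rfl, fun _ => f⟩ : UnaryHom (fun _ : Fin 1 => a) b)) 0 0).symm
    exact (congrArg (fun t => G.map (x := fun _ : Fin 1 => (a : C)) (y := (c : C)) t) h).trans
      ((OperadFunctor.underlying G).map_comp (X := ⟨a⟩) (Y := ⟨b⟩) (Z := ⟨c⟩) _ _)

theorem UnaryHom.ob_eq {P : Operad.{u}} (F : C ⥤ P.Underlying) {n : ℕ} {x : Fin n → C} {y : C}
    (ψ : UnaryHom x y) (i : Fin n) : (F.obj (x ψ.idx)).ob = (F.obj (x i)).ob := by
  obtain ⟨rfl, ψ⟩ := ψ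
  exact congrArg (fun j => (F.obj (x j)).ob) (Subsingleton.elim _ _)

/-- The action on morphisms of the functor between operads that corresponds to a functor into an
underlying category. -/
def UnaryHom.mapUnderlying {P : Operad.{u}} (F : C ⥤ P.Underlying) {n : ℕ} {x : Fin n → C}
    {y : C} (ψ : UnaryHom x y) : P.Hom (fun i => (F.obj (x i)).ob) (F.obj y).ob :=
  P.recast (x := fun _ : Fin 1 => (F.obj (x ψ.idx)).ob) ψ.arity (fun i => ψ.ob_eq F i)
    (F.map (ψ.hom ψ.idx))

theorem UnaryHom.mk_mapUnderlying {P : Operad.{u}} (F : C ⥤ P.Underlying) {n : ℕ}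
    {x : Fin n → C} {y : C} (ψ : UnaryHom x y) (i : Fin n) :
    (⟨_, _, ψ.mapUnderlying F⟩ : P.Arr (F.obj y).ob) =
      ⟨1, fun _ => (F.obj (x i)).ob, F.map (ψ.hom i)⟩ := by
  refine (P.mk_recast _ _ _).trans ?_
  obtain ⟨rfl, ψ⟩ := ψ
  obtain rfl : i = 0 := Subsingleton.elim _ _
  rfl

/-- The functor between operads that corresponds to a functor into an underlying category. -/
def OperadFunctor.ofUnderlying {P : Operad.{u}} (F : C ⥤ P.Underlying) :
    OperadFunctor (Operad.ofCat C) P where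
  obj c := (F.obj c).ob
  map ψ := UnaryHom.mapUnderlying F ψ
  map_id p := F.map_id p
  map_comp {n x y k w} ψ φ := by
    apply P.eq_of_mk_eq
    let i := UnaryHom.idx ψ
    let j := UnaryHom.idx (φ i)
    refine (UnaryHom.mk_mapUnderlying F (UnaryHom.comp (C := C) ψ φ)
      (finSigmaFinEquiv ⟨i, j⟩)).trans ?_
    refine (congrArg (fun t : Σ c : C, c ⟶ (y : C) =>
      (⟨1, fun _ => (F.obj t.1).ob, F.map t.2⟩ : P.Arr (F.obj y).ob))
      (UnaryHom.mk_comp_hom (C := C) ψ φ i j)).trans ?_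
    refine (congrArg (fun t => (⟨1, _, t⟩ : P.Arr (F.obj y).ob))
      (F.map_comp (UnaryHom.hom (φ i) j) (UnaryHom.hom ψ i))).trans ?_
    refine (P.mk_unaryComp _ _).trans ?_
    refine Eq.symm (P.mk_comp_recast (x := fun _ : Fin 1 => (F.obj (x i)).ob)
      (w := fun l a => (F.obj (w l a)).ob) (UnaryHom.arity ψ) (fun l => UnaryHom.ob_eq F ψ l)
      (F.map (UnaryHom.hom ψ i)) (fun l => UnaryHom.mapUnderlying F (φ l))
      (fun _ => F.map (UnaryHom.hom (φ i) j)) ?_)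
    intro l
    have hs : Subsingleton (Fin n) := by
      rw [UnaryHom.arity ψ]; infer_instance
    obtain rfl : l = i := Subsingleton.elim _ _
    exact heq_of_eq (UnaryHom.mk_mapUnderlying F (φ i) j).symm

/-- Functors `j_!(C) ⟶ P` correspond to functors `C ⥤ j^*(P)`. -/
def OperadFunctor.underlyingEquiv (C : Type u) [Category.{u} C] (P : Operad.{u}) :
    OperadFunctor (Operad.ofCat C) P ≃ (C ⥤ P.Underlying) where
  toFun G := G.toUnderlying
  invFun F := OperadFunctor.ofUnderlying F
  left_inv G := by
    refine OperadFunctor.ext rfl ?_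
    refine heq_of_eq ?_
    funext n x y ψ
    obtain ⟨rfl, ψ⟩ := ψ
    apply P.eq_of_mk_eq
    refine (UnaryHom.mk_mapUnderlying (P := P) G.toUnderlying ⟨rfl, ψ⟩ 0).trans ?_
    obtain ⟨c, rfl⟩ : ∃ c : C, x = fun _ => c := ⟨x 0, funext fun i => by
      obtain rfl : i = 0 := Subsingleton.elim _ _
      rfl⟩
    obtain ⟨f, rfl⟩ : ∃ f : c ⟶ (y : C), ψ = fun _ => f := ⟨ψ 0, funext fun i => by
      obtain rfl : i = 0 := Subsingleton.elim _ _
      rfl⟩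
    rfl
  right_inv F := rfl

/-- The version of `OperadFunctor.underlyingEquiv` for symmetric operads. -/
def SymmOperadFunctor.underlyingEquiv (C : Type u) [Category.{u} C] (P : SymmOperad.{u}) :
    SymmOperadFunctor (SymmOperad.ofCat C) P ≃ (C ⥤ P.toOperad.Underlying) where
  toFun G := G.toOperadFunctor.toUnderlying
  invFun F :=
    { toOperadFunctor := OperadFunctor.ofUnderlying F
      map_act := fun {m n x y} σ ψ => by
        obtain ⟨rfl, ψ⟩ := ψ
        obtain rfl : m = 1 := by simpa using Fintype.card_congr σ
        obtain rfl : σ = Equiv.refl _ := Subsingleton.elim _ _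
        rw [P.act_refl]
        exact congrArg (OperadFunctor.ofUnderlying F).map ((SymmOperad.ofCat C).act_refl _) }
  left_inv G := SymmOperadFunctor.ext
    (congrArg OperadFunctor.obj ((OperadFunctor.underlyingEquiv C P.toOperad).left_inv
      G.toOperadFunctor))
    (by
      have h := (OperadFunctor.underlyingEquiv C P.toOperad).left_inv G.toOperadFunctor
      exact (OperadFunctor.ext_iff.1 h).2)
  right_inv F := rfl

end Adjunction

/-- The adjunction `j_! ⊣ j^*` between `Cat` and `Ope`. -/
def jAdj : jShriek.{u} ⊣ jStar.{u} :=
  Adjunction.mkOfHomEquiv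
    { homEquiv := fun C P =>
        (OperadFunctor.underlyingEquiv C P).trans (Functor.equivCatHom C P.Underlying)
      homEquiv_naturality_left_symm := fun _ _ => rfl
      homEquiv_naturality_right := fun _ _ => rfl }

/-- The adjunction `j_! ⊣ j^*` between `Cat` and `Ope_Σ`. -/
def jAdjSymm : jShriekSymm.{u} ⊣ jStarSymm.{u} :=
  Adjunction.mkOfHomEquiv
    { homEquiv := fun C P =>
        (SymmOperadFunctor.underlyingEquiv C P).trans
          (Functor.equivCatHom C P.toOperad.Underlying)
      homEquiv_naturality_left_symm := fun _ _ => rfl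
      homEquiv_naturality_right := fun _ _ => rfl }

/-! ## The model structures -/

/-- The classes of the Rezk model structure on `Cat`: the weak equivalences are the categorical
equivalences, the fibrations are the isofibrations, and the cofibrations are the functors that are
injective on objects. -/
def rezkClasses : ModelClasses Cat.{u, u} where
  weq _ _ F := F.toFunctor.IsEquivalence
  fib X Y F := ∀ (c : X) (d : Y) (ψ : F.toFunctor.obj c ≅ d),
    ∃ (c' : X) (φ : c ≅ c') (h : F.toFunctor.obj c' = d),
      F.toFunctor.map φ.hom ≫ eqToHom h = ψ.hom
  cof _ _ F := Function.Injective F.toFunctor.obj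

/-- A functor between operads is an operadic equivalence if it is essentially surjective and
fully faithful. -/
structure OperadFunctor.IsEquivalence {P Q : Operad.{u}} (F : OperadFunctor P Q) : Prop where
  essSurj : F.underlying.EssSurj
  fullyFaithful : ∀ {n : ℕ} (x : Fin n → P.Ob) (y : P.Ob),
    Function.Bijective (F.map : P.Hom x y → Q.Hom (F.obj ∘ x) (F.obj y))

/-- A functor `F` between operads is an isofibration if each isomorphism `ψ : F p ⟶ q` is the image
of an isomorphism `φ : p ⟶ p'`. Isomorphisms in an operad are those of its underlying category. -/
def OperadFunctor.IsIsofibration {P Q : Operad.{u}} (F : OperadFunctor P Q) : Prop :=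
  ∀ (p : P.Underlying) (q : Q.Underlying) (ψ : F.underlying.obj p ≅ q),
    ∃ (p' : P.Underlying) (φ : p ≅ p') (h : F.underlying.obj p' = q),
      F.underlying.map φ.hom ≫ eqToHom h = ψ.hom

/-- The classes of the model structure on `Ope`: operadic equivalences, isofibrations and functors
that are injective on objects. -/
def opeClasses : ModelClasses Operad.{u} where
  weq _ _ F := OperadFunctor.IsEquivalence F
  fib _ _ F := OperadFunctor.IsIsofibration F
  cof _ _ F := Function.Injective (OperadFunctor.obj F)

/-- The classes of the model structure on `Ope_Σ`: operadic equivalences, isofibrations and functors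
that are injective on objects. -/
def opeSymmClasses : ModelClasses SymmOperad.{u} where
  weq _ _ F := OperadFunctor.IsEquivalence (SymmOperadFunctor.toOperadFunctor F)
  fib _ _ F := OperadFunctor.IsIsofibration (SymmOperadFunctor.toOperadFunctor F)
  cof _ _ F := Function.Injective (SymmOperadFunctor.toOperadFunctor F).obj

/-! ## Sequences of inputs -/

theorem append_concatSeq {O : Type*} {n : ℕ} {k : Fin (n + 1) → ℕ} (w : ∀ i, Fin (k i) → O)
    (h : ∑ i, k i = (∑ i : Fin n, k i.castSucc) + k (Fin.last n)) (i : Fin (n + 1))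
    (j : Fin (k i)) :
    Fin.append (concatSeq fun i : Fin n => w i.castSucc) (w (Fin.last n))
      (Fin.cast h (finSigmaFinEquiv ⟨i, j⟩)) = w i j := by
  induction i using Fin.lastCases with
  | last =>
    have : Fin.cast h (finSigmaFinEquiv ⟨Fin.last n, j⟩) = Fin.natAdd _ j := by
      apply Fin.ext
      simp
      rfl
    rw [this, Fin.append_right]
  | cast i =>
    have : Fin.cast h (finSigmaFinEquiv ⟨i.castSucc, j⟩) = Fin.castAdd _
        (finSigmaFinEquiv (n := fun i : Fin n => k i.castSucc) ⟨i, j⟩) := by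
      apply Fin.ext
      simp
    rw [this, Fin.append_left]
    exact congrArg (fun t : Σ i : Fin n, Fin (k i.castSucc) => w t.1.castSucc t.2)
      (finSigmaFinEquiv.symm_apply_apply ⟨i, j⟩)

/-- Passing to lists hides the lengths from the type, so the unit and associativity laws of
concatenation become identities about `List.flatten`. -/
theorem ofFn_concatSeq {O : Type*} {n : ℕ} {k : Fin n → ℕ} (w : ∀ i, Fin (k i) → O) :
    List.ofFn (concatSeq w) = (List.ofFn fun i => List.ofFn (w i)).flatten := by
  induction n with
  | zero => simp
  | succ n ih =>
    have h : ∑ i, k i = (∑ i : Fin n, k i.castSucc) + k (Fin.last n) := Fin.sum_univ_castSucc k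
    rw [List.ofFn_succ', List.concat_eq_append, List.flatten_append, ← ih]
    simp only [List.flatten_cons, List.flatten_nil, List.append_nil]
    rw [← List.ofFn_fin_append]
    refine (List.ofFn_congr h _).trans ?_
    congr 1
    funext a
    obtain ⟨b, rfl⟩ : ∃ b, a = Fin.cast h b := ⟨Fin.cast h.symm a, rfl⟩
    obtain ⟨⟨i, j⟩, rfl⟩ := finSigmaFinEquiv.surjective b
    refine Eq.trans ?_ (append_concatSeq w h i j).symm
    exact congrArg (fun t : Σ i, Fin (k i) => w t.1 t.2)
      (finSigmaFinEquiv.symm_apply_apply ⟨i, j⟩)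

/-- This lemma, the next two and `concatSeq_comp_blockPerm` equate the input sequences on the two
sides of the operad axioms. Faithfulness compares only morphisms with the same inputs, so these
equalities are needed separately. -/
theorem sigma_concatSeq_one {O : Type*} {n : ℕ} (x : Fin n → O) :
    (⟨_, concatSeq fun _ : Fin 1 => x⟩ : Σ m, Fin m → O) = ⟨n, x⟩ :=
  List.ofFn_inj'.1 (by rw [ofFn_concatSeq]; simp)

theorem sigma_concatSeq_const_one {O : Type*} {n : ℕ} (x : Fin n → O) :
    (⟨_, concatSeq fun i => fun _ : Fin 1 => x i⟩ : Σ m, Fin m → O) = ⟨n, x⟩ := by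
  refine List.ofFn_inj'.1 ?_
  rw [ofFn_concatSeq]
  simp [List.flatten_eq_flatMap, List.ofFn_eq_map, List.flatMap_map, ← List.map_eq_flatMap]

theorem sigma_concatSeq_assoc {O : Type*} {n : ℕ} {k : Fin n → ℕ} {l : ∀ i, Fin (k i) → ℕ}
    (v : ∀ i j, Fin (l i j) → O) :
    (⟨_, concatSeq fun a : Fin (∑ i, k i) =>
      v (finSigmaFinEquiv.symm a).1 (finSigmaFinEquiv.symm a).2⟩ : Σ m, Fin m → O) =
      ⟨_, concatSeq fun i => concatSeq (v i)⟩ := by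
  refine List.ofFn_inj'.1 ?_
  rw [ofFn_concatSeq, ofFn_concatSeq]
  refine (congrArg List.flatten (ofFn_concatSeq fun i j => List.ofFn (v i j))).trans ?_
  simp only [ofFn_concatSeq]
  rw [List.flatten_flatten, List.map_ofFn]
  rfl

theorem concatSeq_comp_blockPerm {O : Type*} {m n : ℕ} {k' : Fin m → ℕ} {k : Fin n → ℕ}
    (w : ∀ i, Fin (k i) → O) (σ : Fin m ≃ Fin n) (τ : ∀ j, Fin (k' j) ≃ Fin (k (σ j))) :
    concatSeq (fun j => w (σ j) ∘ τ j) = concatSeq w ∘ blockPerm σ τ := by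
  funext a
  obtain ⟨⟨i, j⟩, rfl⟩ := finSigmaFinEquiv.surjective a
  refine (congrArg (fun t : Σ j, Fin (k' j) => w (σ t.1) (τ t.1 t.2))
    (finSigmaFinEquiv.symm_apply_apply ⟨i, j⟩)).trans ?_
  have h : blockPerm σ τ (finSigmaFinEquiv ⟨i, j⟩) = finSigmaFinEquiv ⟨σ i, τ i j⟩ := by
    simp [blockPerm, Equiv.sigmaCongr]
  refine Eq.trans ?_ (congrArg (concatSeq w) h).symm
  exact (congrArg (fun t : Σ i, Fin (k i) => w t.1 t.2)
    (finSigmaFinEquiv.symm_apply_apply ⟨σ i, τ i j⟩)).symm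

/-! ## Morphisms with varying inputs and output -/

namespace Operad

/-- All morphisms of an operad. -/
abbrev Mor (P : Operad.{u}) : Type u := Σ y : P.Ob, P.Arr y

/-- A morphism of an operad, as an element of the set of all morphisms. -/
abbrev toMor (P : Operad.{u}) {n : ℕ} {x : Fin n → P.Ob} {y : P.Ob} (ψ : P.Hom x y) : P.Mor :=
  ⟨y, n, x, ψ⟩

/-- Comparing morphisms in the set of all morphisms loses nothing inside one hom-set. This lets
`toMor` stand in for heterogeneous equality when inputs and outputs agree only propositionally. -/
theorem eq_of_toMor_eq (P : Operad.{u}) {n : ℕ} {x : Fin n → P.Ob} {y : P.Ob} {ψ φ : P.Hom x y}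
    (h : P.toMor ψ = P.toMor φ) : ψ = φ := by
  simpa using h

theorem toMor_id_congr (P : Operad.{u}) {p q : P.Ob} (h : p = q) :
    P.toMor (P.id p) = P.toMor (P.id q) := by
  subst h; rfl

theorem toMor_comp_congr (P : Operad.{u}) {n : ℕ} {x x' : Fin n → P.Ob} {y y' : P.Ob}
    {ψ : P.Hom x y} {ψ' : P.Hom x' y'} (h : P.toMor ψ = P.toMor ψ')
    {k k' : Fin n → ℕ} {w : ∀ i, Fin (k i) → P.Ob} {w' : ∀ i, Fin (k' i) → P.Ob}
    {φ : ∀ i, P.Hom (w i) (x i)} {φ' : ∀ i, P.Hom (w' i) (x' i)}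
    (hφ : ∀ i, P.toMor (φ i) = P.toMor (φ' i)) :
    P.toMor (P.comp ψ φ) = P.toMor (P.comp ψ' φ') := by
  cases h
  exact congrArg (Sigma.mk y) (P.mk_comp_congr ψ φ φ' fun i => by simpa using hφ i)

end Operad

theorem SymmOperad.toMor_act_congr (P : SymmOperad.{u}) {m n : ℕ} {x x' : Fin n → P.Ob}
    {y y' : P.Ob} {ψ : P.Hom x y} {ψ' : P.Hom x' y'} (σ : Fin m ≃ Fin n)
    (h : P.toMor ψ = P.toMor ψ') :
    P.toMor (P.act σ ψ) = P.toMor (P.act σ ψ') := by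
  cases h; rfl

namespace OperadFunctor

theorem toMor_map_congr {P Q : Operad.{u}} (F : OperadFunctor P Q) {m n : ℕ} {x : Fin m → P.Ob}
    {x' : Fin n → P.Ob} {y y' : P.Ob} {ψ : P.Hom x y} {ψ' : P.Hom x' y'}
    (h : P.toMor ψ = P.toMor ψ') : Q.toMor (F.map ψ) = Q.toMor (F.map ψ') := by
  cases h; rfl

theorem toMor_congr {P Q : Operad.{u}} {F G : OperadFunctor P Q} (h : F = G) {n : ℕ}
    {x : Fin n → P.Ob} {y : P.Ob} (ψ : P.Hom x y) : Q.toMor (F.map ψ) = Q.toMor (G.map ψ) := by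
  cases h; rfl

theorem ext_toMor {P Q : Operad.{u}} {F G : OperadFunctor P Q} (hobj : ∀ p, F.obj p = G.obj p)
    (hmap : ∀ {n : ℕ} {x : Fin n → P.Ob} {y : P.Ob} (ψ : P.Hom x y),
      Q.toMor (F.map ψ) = Q.toMor (G.map ψ)) : F = G := by
  obtain ⟨obj, map, _, _⟩ := F
  obtain ⟨obj', map', _, _⟩ := G
  obtain rfl : obj = obj' := funext hobj
  have : @map = @map' := by
    funext n x y ψ
    exact Q.eq_of_toMor_eq (hmap ψ)
  subst this
  rfl

/-- A functor between the operads underlying symmetric operads is equivariant if it is a functor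
of symmetric operads. -/
def IsEquivariant {P Q : SymmOperad.{u}} (F : OperadFunctor P.toOperad Q.toOperad) : Prop :=
  ∀ {m n : ℕ} {x : Fin n → P.Ob} {y : P.Ob} (σ : Fin m ≃ Fin n) (ψ : P.Hom x y),
    F.map (P.act σ ψ) = Q.act σ (F.map ψ)

end OperadFunctor

theorem SymmOperad.forget_map_injective {P Q : SymmOperad.{u}} {F G : P ⟶ Q}
    (h : SymmOperadFunctor.toOperadFunctor F = SymmOperadFunctor.toOperadFunctor G) : F = G := by
  obtain ⟨F, _⟩ := F
  obtain ⟨G, _⟩ := G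
  cases h
  rfl

/-! ## Operads detected by families of representations -/

/-- The data of an operad, without the axioms. -/
structure RawOperad : Type (u + 1) where
  Ob : Type u
  Hom : ∀ {n : ℕ}, (Fin n → Ob) → Ob → Type u
  id : ∀ p : Ob, Hom (fun _ : Fin 1 => p) p
  comp : ∀ {n : ℕ} {x : Fin n → Ob} {y : Ob} {k : Fin n → ℕ} {w : ∀ i, Fin (k i) → Ob},
    Hom x y → (∀ i, Hom (w i) (x i)) → Hom (concatSeq w) y

namespace RawOperad

/-- A map from the data of an operad to an operad, compatible with identities and compositions. -/
structure Rep (R : RawOperad.{u}) (P : Operad.{u}) where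
  obj : R.Ob → P.Ob
  map : ∀ {n : ℕ} {x : Fin n → R.Ob} {y : R.Ob}, R.Hom x y → P.Hom (obj ∘ x) (obj y)
  map_id : ∀ p, map (R.id p) = P.id (obj p)
  map_comp : ∀ {n : ℕ} {x : Fin n → R.Ob} {y : R.Ob} {k : Fin n → ℕ} {w : ∀ i, Fin (k i) → R.Ob}
    (ψ : R.Hom x y) (φ : ∀ i, R.Hom (w i) (x i)),
    map (R.comp ψ φ) = P.comp (w := fun i => obj ∘ w i) (map ψ) (fun i => map (φ i))

/-- A family of representations that is jointly faithful. -/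
def JointlyFaithful {R : RawOperad.{u}} {I : Type*} {P : I → Operad.{u}}
    (F : ∀ i, R.Rep (P i)) : Prop :=
  ∀ ⦃n : ℕ⦄ ⦃x : Fin n → R.Ob⦄ ⦃y : R.Ob⦄ (ψ φ : R.Hom x y),
    (∀ i, (F i).map ψ = (F i).map φ) → ψ = φ

section

variable {R : RawOperad.{u}} {I : Type*} {P : I → Operad.{u}} {F : ∀ i, R.Rep (P i)}

/-- The equality of inputs is a hypothesis because the representations need not be jointly injective
on objects. -/
theorem JointlyFaithful.mk_eq (hF : JointlyFaithful F) {m n : ℕ} {x : Fin m → R.Ob}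
    {x' : Fin n → R.Ob} {y : R.Ob} (ψ : R.Hom x y) (ψ' : R.Hom x' y)
    (hs : (⟨m, x⟩ : Σ n, Fin n → R.Ob) = ⟨n, x'⟩)
    (h : ∀ i, (⟨_, _, (F i).map ψ⟩ : (P i).Arr ((F i).obj y)) = ⟨_, _, (F i).map ψ'⟩) :
    (⟨m, x, ψ⟩ : Σ (m : ℕ) (z : Fin m → R.Ob), R.Hom z y) = ⟨n, x', ψ'⟩ := by
  cases hs
  obtain rfl : ψ = ψ' := hF _ _ fun i => (P i).eq_of_mk_eq (h i)
  rfl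

/-- The axioms of an operad hold as soon as there is a jointly faithful family of
representations in operads. -/
def toOperad (R : RawOperad.{u}) {P : I → Operad.{u}} (F : ∀ i, R.Rep (P i))
    (hF : JointlyFaithful F) : Operad.{u} where
  Ob := R.Ob
  Hom := R.Hom
  id := R.id
  comp := R.comp
  id_comp {_ x _} ψ := hF.mk_eq _ _ (sigma_concatSeq_one x) fun i => by
    rw [(F i).map_comp, (F i).map_id]
    exact (P i).id_comp (x := (F i).obj ∘ x) ((F i).map ψ)
  comp_id {_ x _} ψ := hF.mk_eq _ _ (sigma_concatSeq_const_one x) fun i => by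
    rw [(F i).map_comp]
    simp only [(F i).map_id]
    exact (P i).comp_id (x := (F i).obj ∘ x) ((F i).map ψ)
  assoc {_ _ _ _ w _ v} ψ φ χ := hF.mk_eq _ _ (sigma_concatSeq_assoc v) fun i => by
    refine (congrArg (fun t => (⟨_, _, t⟩ : (P i).Arr _))
      ((F i).map_comp (R.comp ψ φ) _)).trans ?_
    rw [(F i).map_comp ψ φ]
    refine ((P i).assoc (w := fun a => (F i).obj ∘ w a) (v := fun a b => (F i).obj ∘ v a b)
      ((F i).map ψ) (fun a => (F i).map (φ a)) (fun a b => (F i).map (χ a b))).trans ?_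
    refine Eq.symm ((congrArg (fun t => (⟨_, _, t⟩ : (P i).Arr _))
      ((F i).map_comp ψ _)).trans ?_)
    exact congrArg (fun t => (⟨_, _, (P i).comp ((F i).map ψ) t⟩ : (P i).Arr _))
      (funext fun a => (F i).map_comp (φ a) (χ a))

/-- The representation of the operad given by a representation of its data. -/
def toOperadFunctor (R : RawOperad.{u}) {P : I → Operad.{u}} (F : ∀ i, R.Rep (P i))
    (hF : JointlyFaithful F) (i : I) : OperadFunctor (R.toOperad F hF) (P i) where
  obj := (F i).obj
  map ψ := (F i).map ψ
  map_id := (F i).map_id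
  map_comp := (F i).map_comp

/-- The axioms of a symmetric operad hold as soon as there is a jointly faithful family of
equivariant representations in symmetric operads. -/
def toSymmOperad (R : RawOperad.{u}) {P : I → SymmOperad.{u}} (F : ∀ i, R.Rep (P i).toOperad)
    (hF : JointlyFaithful F)
    (act : ∀ {m n : ℕ} {x : Fin n → R.Ob} {y : R.Ob} (σ : Fin m ≃ Fin n), R.Hom x y →
      R.Hom (x ∘ σ) y)
    (hact : ∀ i {m n : ℕ} {x : Fin n → R.Ob} {y : R.Ob} (σ : Fin m ≃ Fin n) (ψ : R.Hom x y),
      (F i).map (act σ ψ) = (P i).act σ ((F i).map ψ)) : SymmOperad.{u} where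
  toOperad := R.toOperad F hF
  act := act
  act_refl ψ := hF _ _ fun i => (hact i _ _).trans ((P i).act_refl _)
  act_trans σ τ ψ := hF _ _ fun i => by
    refine (hact i _ _).trans (((P i).act_trans _ _ _).trans ?_)
    refine Eq.trans ?_ (hact i τ (act σ ψ)).symm
    exact congrArg ((P i).act τ) (hact i σ ψ).symm
  comp_act {_ _ _ _ _ _ w} σ τ ψ φ := hF.mk_eq _ _
    (congrArg (Sigma.mk _) (concatSeq_comp_blockPerm w σ τ)) fun i => by
      refine (congrArg (fun t => (⟨_, _, t⟩ : (P i).Arr _))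
        ((F i).map_comp (act σ ψ) fun j => act (τ j) (φ (σ j)))).trans ?_
      rw [hact i σ ψ]
      refine (congrArg (fun t => (⟨_, _, (P i).comp ((P i).act σ ((F i).map ψ)) t⟩ : (P i).Arr _))
        (funext fun j => hact i (τ j) (φ (σ j)))).trans ?_
      refine ((P i).comp_act (w := fun a => (F i).obj ∘ w a) σ τ ((F i).map ψ)
        (fun a => (F i).map (φ a))).trans ?_
      refine Eq.symm ((congrArg (fun t => (⟨_, _, t⟩ : (P i).Arr _)) (hact i _ _)).trans ?_)
      exact congrArg (fun t => (⟨_, _, (P i).act (blockPerm σ τ) t⟩ : (P i).Arr _))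
        ((F i).map_comp ψ φ)

end

end RawOperad

theorem RawOperad.JointlyFaithful.toMor_eq {R : RawOperad.{u}} {I : Type*} {P : I → Operad.{u}}
    {F : ∀ i, R.Rep (P i)} (hF : JointlyFaithful F) {n : ℕ} {x x' : Fin n → R.Ob} {y y' : R.Ob}
    (ψ : R.Hom x y) (ψ' : R.Hom x' y') (hx : ∀ a, x a = x' a) (hy : y = y')
    (h : ∀ i, (P i).toMor ((F i).map ψ) = (P i).toMor ((F i).map ψ')) :
    (R.toOperad F hF).toMor (y := y) ψ = (R.toOperad F hF).toMor (y := y') ψ' := by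
  subst hy
  obtain rfl : x = x' := funext hx
  obtain rfl : ψ = ψ' := hF _ _ fun i => (P i).eq_of_toMor_eq (h i)
  rfl

/-! ## Limits of operads -/

namespace Operad

section Limits

variable {J : Type u} [Category.{u} J] (F : J ⥤ Operad.{u})

/-- The data of the limit of a diagram of operads. -/
def limitRaw : RawOperad.{u} where
  Ob := { p : ∀ j, (F.obj j).Ob // ∀ ⦃i j⦄ (f : i ⟶ j), OperadFunctor.obj (F.map f) (p i) = p j }
  Hom x y := { ψ : ∀ j, (F.obj j).Hom (fun a => (x a).1 j) (y.1 j) //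
    -- Compatibility is stated with `toMor`, since the transition functors match the inputs and
    -- outputs of the components only propositionally.
    ∀ ⦃i j⦄ (f : i ⟶ j),
      (F.obj j).toMor (OperadFunctor.map (F.map f) (ψ i)) = (F.obj j).toMor (ψ j) }
  id p := ⟨fun j => (F.obj j).id (p.1 j), fun i j f =>
    (congrArg (F.obj j).toMor (OperadFunctor.map_id (F.map f) (p.1 i))).trans
      ((F.obj j).toMor_id_congr (p.2 f))⟩
  comp {_ _ _ _ w} ψ φ := ⟨fun j => (F.obj j).comp (w := fun a b => (w a b).1 j) (ψ.1 j)
      (fun a => (φ a).1 j), fun i j f =>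
    (congrArg (F.obj j).toMor (OperadFunctor.map_comp (F.map f) (w := fun a b => (w a b).1 i)
      (ψ.1 i) fun a => (φ a).1 i)).trans
      ((F.obj j).toMor_comp_congr (ψ.2 f) fun a => (φ a).2 f)⟩

/-- The projections from the limit of a diagram of operads. -/
def limitRep (j : J) : (limitRaw F).Rep (F.obj j) where
  obj p := p.1 j
  map ψ := ψ.1 j
  map_id _ := rfl
  map_comp _ _ := rfl

theorem jointlyFaithful_limitRep : RawOperad.JointlyFaithful (limitRep F) :=
  fun _ _ _ _ _ h => Subtype.ext (funext h)

/-- The limit of a diagram of operads. -/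
def limitOperad : Operad.{u} :=
  (limitRaw F).toOperad (limitRep F) (jointlyFaithful_limitRep F)

/-- The projections from the limit of a diagram of operads. -/
def limitProj (j : J) : OperadFunctor (limitOperad F) (F.obj j) :=
  (limitRaw F).toOperadFunctor (limitRep F) (jointlyFaithful_limitRep F) j

/-- The limit cone of a diagram of operads. -/
def limitCone : Cone F where
  pt := limitOperad F
  π :=
    { app := limitProj F
      naturality := fun i j f => (OperadFunctor.ext_toMor
        (F := (limitProj F i).comp (F.map f)) (G := limitProj F j)
        (fun p => Subtype.property p f) (fun ψ => Subtype.property ψ f)).symm }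

/-- The functor to the limit of a diagram of operads given by a cone. -/
def limitLift (s : Cone F) : OperadFunctor s.pt (limitOperad F) where
  obj p := ⟨fun j => OperadFunctor.obj (s.π.app j) p, fun _ _ f =>
    congrArg (fun G => OperadFunctor.obj G p) (s.w f)⟩
  map ψ := ⟨fun j => OperadFunctor.map (s.π.app j) ψ, fun _ _ f =>
    OperadFunctor.toMor_congr (s.w f) ψ⟩
  map_id p := Subtype.ext (funext fun j => OperadFunctor.map_id (s.π.app j) p)
  map_comp ψ φ := Subtype.ext (funext fun j => OperadFunctor.map_comp (s.π.app j) ψ φ)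

theorem limit_hom_ext {P : Operad.{u}} {G H : OperadFunctor P (limitOperad F)}
    (h : ∀ j, G.comp (limitProj F j) = H.comp (limitProj F j)) : G = H := by
  have hobj (p : P.Ob) : G.obj p = H.obj p :=
    Subtype.ext (funext fun j => congrArg (fun K => OperadFunctor.obj K p) (h j))
  exact OperadFunctor.ext_toMor hobj fun ψ =>
    (jointlyFaithful_limitRep F).toMor_eq _ _ (fun a => hobj _) (hobj _)
      fun j => OperadFunctor.toMor_congr (h j) ψ

end Limits

instance : HasLimits Operad.{u} where
  has_limits_of_shape _ _ :=
    { has_limit := fun F => ⟨⟨limitCone F,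
        { lift := limitLift F
          fac := fun _ _ => rfl
          uniq := fun _ _ hm => limit_hom_ext F hm }⟩⟩ }

end Operad

namespace SymmOperad

section Limits

variable {J : Type u} [Category.{u} J] (F : J ⥤ SymmOperad.{u})

/-- The limit of a diagram of symmetric operads. -/
def limitSymmOperad : SymmOperad.{u} :=
  (Operad.limitRaw (F ⋙ forget)).toSymmOperad (P := F.obj) (Operad.limitRep (F ⋙ forget))
    (Operad.jointlyFaithful_limitRep (F ⋙ forget))
    (fun {_ _ x _} σ ψ => ⟨fun j => (F.obj j).act (x := fun a => (x a).1 j) σ (ψ.1 j),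
      fun i j f => (congrArg (F.obj j).toMor (SymmOperadFunctor.map_act (F.map f)
        (x := fun a => (x a).1 i) σ (ψ.1 i))).trans ((F.obj j).toMor_act_congr σ (ψ.2 f))⟩)
    (fun _ _ _ _ _ _ _ => rfl)

/-- The limit cone of a diagram of symmetric operads. -/
def limitCone : Cone F where
  pt := limitSymmOperad F
  π :=
    { app := fun j =>
        { toOperadFunctor := Operad.limitProj (F ⋙ forget) j
          map_act := fun _ _ => rfl }
      naturality := fun _ _ f => forget_map_injective
        ((Operad.limitCone (F ⋙ forget)).π.naturality f) }

end Limits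

instance : HasLimits SymmOperad.{u} where
  has_limits_of_shape _ _ :=
    { has_limit := fun F => ⟨⟨limitCone F,
        { lift := fun s =>
            { toOperadFunctor := Operad.limitLift (F ⋙ forget) (forget.mapCone s)
              map_act := fun σ ψ => Subtype.ext (funext fun j =>
                SymmOperadFunctor.map_act (s.π.app j) σ ψ) }
          fac := fun _ _ => rfl
          uniq := fun _ _ hm => forget_map_injective
            (Operad.limit_hom_ext (F ⋙ forget) fun j =>
              congrArg SymmOperadFunctor.toOperadFunctor (hm j)) }⟩⟩ }

end SymmOperad

/-! ## Colimits of operads -/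

namespace Operad

section Colimits

variable {J : Type u} [Category.{u} J] (F : J ⥤ Operad.{u})

/-- The objects of the colimit of a diagram of operads. -/
def ColimitOb : Type u :=
  Quot fun a b : Σ j, (F.obj j).Ob => ∃ f : a.1 ⟶ b.1, OperadFunctor.obj (F.map f) a.2 = b.2

/-- The maps to the set of objects of the colimit. -/
def colimitObι (j : J) (p : (F.obj j).Ob) : ColimitOb F := Quot.mk _ ⟨j, p⟩

/-- Formal composites of morphisms of the operads in a diagram. Permutations are allowed in
these composites if `S` holds. -/
inductive ColimitTerm (S : Prop) : ∀ {n : ℕ}, (Fin n → ColimitOb F) → ColimitOb F → Type u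
  | of (j : J) {n : ℕ} {x : Fin n → (F.obj j).Ob} {y : (F.obj j).Ob} (ψ : (F.obj j).Hom x y) :
      ColimitTerm S (colimitObι F j ∘ x) (colimitObι F j y)
  | id (p : ColimitOb F) : ColimitTerm S (fun _ : Fin 1 => p) p
  | comp {n : ℕ} {x : Fin n → ColimitOb F} {y : ColimitOb F} {k : Fin n → ℕ}
      {w : ∀ i, Fin (k i) → ColimitOb F} (t : ColimitTerm S x y)
      (s : ∀ i, ColimitTerm S (w i) (x i)) : ColimitTerm S (concatSeq w) y
  | act (h : S) {m n : ℕ} {x : Fin n → ColimitOb F} {y : ColimitOb F} (σ : Fin m ≃ Fin n)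
      (t : ColimitTerm S x y) : ColimitTerm S (x ∘ σ) y

variable {F}

/-- The map from the objects of the colimit given by a cocone. -/
def colimitObDesc (c : Cocone F) : ColimitOb F → c.pt.Ob :=
  Quot.lift (fun a => OperadFunctor.obj (c.ι.app a.1) a.2) (by
    rintro ⟨i, p⟩ ⟨j, q⟩ ⟨f, hf⟩
    dsimp only at f hf
    subst hf
    exact (congrArg (fun G => OperadFunctor.obj G p) (c.w f)).symm)

/-- Operations on the morphisms of an operad that have the form of actions of the symmetric
groups. -/
abbrev ActionData (P : Operad.{u}) : Type u :=
  ∀ {m n : ℕ} {x : Fin n → P.Ob} {y : P.Ob} (σ : Fin m ≃ Fin n), P.Hom x y → P.Hom (x ∘ σ) y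

theorem toMor_actionData_congr {P : Operad.{u}} (α : P.ActionData) {m n : ℕ}
    {x x' : Fin n → P.Ob} {y y' : P.Ob} {ψ : P.Hom x y} {ψ' : P.Hom x' y'} (σ : Fin m ≃ Fin n)
    (h : P.toMor ψ = P.toMor ψ') : P.toMor (α σ ψ) = P.toMor (α σ ψ') := by
  cases h; rfl

/-- The value of a formal composite in a cocone. -/
def ColimitTerm.eval {S : Prop} (c : Cocone F) (α : S → c.pt.ActionData) {n : ℕ}
    {x : Fin n → ColimitOb F} {y : ColimitOb F} :
    ColimitTerm F S x y → c.pt.Hom (colimitObDesc c ∘ x) (colimitObDesc c y)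
  | of j ψ => OperadFunctor.map (c.ι.app j) ψ
  | id p => c.pt.id (colimitObDesc c p)
  | comp (w := w) t s =>
      c.pt.comp (w := fun i => colimitObDesc c ∘ w i) (t.eval c α) fun i => (s i).eval c α
  | act h σ t => α h σ (t.eval c α)

variable {S : Prop} {I : Type*} (c : I → Cocone F) (α : ∀ i, S → (c i).pt.ActionData)

/-- Formal composites are identified if they have the same values in all given cocones. -/
def colimitSetoid {n : ℕ} (x : Fin n → ColimitOb F) (y : ColimitOb F) :
    Setoid (ColimitTerm F S x y) where
  r s t := ∀ i, s.eval (c i) (α i) = t.eval (c i) (α i)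
  iseqv := ⟨fun _ _ => rfl, fun h i => (h i).symm, fun h h' i => (h i).trans (h' i)⟩

/-- The value in a cocone of a class of formal composites. -/
def colimitEval (i : I) {n : ℕ} {x : Fin n → ColimitOb F} {y : ColimitOb F} :
    Quotient (colimitSetoid c α x y) →
      (c i).pt.Hom (colimitObDesc (c i) ∘ x) (colimitObDesc (c i) y) :=
  Quotient.lift (fun t => t.eval (c i) (α i)) fun _ _ h => h i

/-- Composition and permutation of classes are defined through chosen representatives; evaluation
does not see the choice. -/
theorem eval_out (i : I) {n : ℕ} {x : Fin n → ColimitOb F} {y : ColimitOb F}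
    (t : Quotient (colimitSetoid c α x y)) :
    t.out.eval (c i) (α i) = colimitEval c α i t :=
  congrArg (colimitEval c α i) t.out_eq

/-- The data of the colimit of a diagram of operads. -/
noncomputable def colimitRaw : RawOperad.{u} where
  Ob := ColimitOb F
  Hom x y := Quotient (colimitSetoid c α x y)
  id p := Quotient.mk _ (.id p)
  comp ψ φ := Quotient.mk _ (.comp ψ.out fun i => (φ i).out)

/-- The representation of the data of the colimit given by a cocone. -/
noncomputable def colimitRep (i : I) : (colimitRaw c α).Rep (c i).pt where
  obj := colimitObDesc (c i)
  map := colimitEval c α i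
  map_id _ := rfl
  map_comp {_ _ _ _ w} ψ φ := by
    change (c i).pt.comp (w := fun a => colimitObDesc (c i) ∘ w a) (ψ.out.eval (c i) (α i))
      (fun a => (φ a).out.eval (c i) (α i)) = _
    exact congr (congrArg (fun t => (c i).pt.comp (w := fun a => colimitObDesc (c i) ∘ w a) t)
      (eval_out c α i ψ)) (funext fun a => eval_out c α i (φ a))

/-- The relation on formal composites was defined to make this true. Being a proposition, it may
quantify over all cocones without raising the universe of the quotient. -/
theorem jointlyFaithful_colimitRep : RawOperad.JointlyFaithful (colimitRep c α) := by
  intro n x y ψ φ h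
  induction ψ using Quotient.inductionOn
  induction φ using Quotient.inductionOn
  exact Quotient.sound h

/-- The colimit of a diagram of operads. -/
noncomputable def colimitOperad : Operad.{u} :=
  (colimitRaw c α).toOperad (colimitRep c α) (jointlyFaithful_colimitRep c α)

/-- The functors to the colimit of a diagram of operads. -/
noncomputable def colimitι (j : J) : OperadFunctor (F.obj j) (colimitOperad c α) where
  obj := colimitObι F j
  map ψ := Quotient.mk _ (.of j ψ)
  map_id p := Quotient.sound fun i => OperadFunctor.map_id ((c i).ι.app j) p
  map_comp {_ _ _ _ w} ψ φ := jointlyFaithful_colimitRep c α _ _ fun i => by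
    refine (OperadFunctor.map_comp ((c i).ι.app j) ψ φ).trans ?_
    exact ((colimitRep c α i).map_comp (w := fun a => colimitObι F j ∘ w a)
      (Quotient.mk _ (.of j ψ)) (fun a => Quotient.mk _ (.of j (φ a)))).symm

/-- The cocone of the colimit of a diagram of operads. -/
noncomputable def colimitCocone : Cocone F where
  pt := colimitOperad c α
  ι :=
    { app := colimitι c α
      naturality := fun j j' f => by
        have hobj (p : (F.obj j).Ob) :
            colimitObι F j' (OperadFunctor.obj (F.map f) p) = colimitObι F j p :=
          (Quot.sound ⟨f, rfl⟩).symm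
        exact OperadFunctor.ext_toMor hobj fun ψ =>
          (jointlyFaithful_colimitRep c α).toMor_eq _ _ (fun a => hobj _) (hobj _)
            fun i => OperadFunctor.toMor_congr ((c i).w f) ψ }

/-- The functor from the colimit given by a cocone. -/
noncomputable def colimitDesc (i : I) : OperadFunctor (colimitOperad c α) (c i).pt :=
  (colimitRaw c α).toOperadFunctor (colimitRep c α) (jointlyFaithful_colimitRep c α) i

/-- Induction on formal composites: `m` is prescribed on generators and respects identities and
compositions. Permutations are the one constructor a plain operad functor need not respect, hence
`hact`, which is vacuous when `S` is `False`. -/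
theorem colimitDesc_unique (i : I) (m : OperadFunctor (colimitOperad c α) (c i).pt)
    (hm : ∀ j, (colimitι c α j).comp m = (c i).ι.app j)
    (hact : ∀ (h : S) {k n : ℕ} {x : Fin n → ColimitOb F} {y : ColimitOb F} (σ : Fin k ≃ Fin n)
      (t : ColimitTerm F S x y),
      m.map (x := x ∘ σ) (y := y) (Quotient.mk (colimitSetoid c α _ _) (.act h σ t)) =
        α i h σ (m.map (x := x) (y := y) (Quotient.mk (colimitSetoid c α _ _) t))) :
    m = colimitDesc c α i := by
  have hobj (p : ColimitOb F) : m.obj p = colimitObDesc (c i) p := by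
    obtain ⟨⟨j, p⟩, rfl⟩ := Quot.exists_rep p
    exact congrArg (fun G => OperadFunctor.obj G p) (hm j)
  refine OperadFunctor.ext_toMor hobj fun ψ => ?_
  obtain ⟨t, rfl⟩ := Quotient.exists_rep ψ
  induction t with
  | of j ψ => exact OperadFunctor.toMor_congr (hm j) ψ
  | id p =>
    exact (congrArg (c i).pt.toMor (m.map_id p)).trans ((c i).pt.toMor_id_congr (hobj p))
  | @comp n x y k w t s iht ihs =>
    -- This is not definitional, because composition in the colimit passes through representatives;
    -- it is tested in all cocones.
    have h : Quotient.mk (colimitSetoid c α _ _) (.comp t s) =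
        (colimitOperad c α).comp (x := x) (y := y) (w := w) (Quotient.mk _ t)
          (fun a => Quotient.mk _ (s a)) :=
      jointlyFaithful_colimitRep c α _ _ fun i =>
        ((colimitRep c α i).map_comp (Quotient.mk _ t) fun a => Quotient.mk _ (s a)).symm
    refine (congrArg (fun t => (c i).pt.toMor (m.map (x := concatSeq w) (y := y) t)) h).trans ?_
    refine (congrArg (c i).pt.toMor (m.map_comp _ _)).trans ?_
    refine Eq.symm ((congrArg (fun t => (c i).pt.toMor ((colimitDesc c α i).map
      (x := concatSeq w) (y := y) t)) h).trans ?_)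
    refine (congrArg (c i).pt.toMor ((colimitDesc c α i).map_comp _ _)).trans ?_
    exact (c i).pt.toMor_comp_congr iht.symm
      fun a => (ihs a).symm
  | @act h m n x y σ t ih =>
    exact (congrArg (c i).pt.toMor (hact h σ t)).trans (toMor_actionData_congr (α i h) σ ih)

end Colimits

instance : HasColimits Operad.{u} where
  has_colimits_of_shape _ _ :=
    { has_colimit := fun F =>
        -- With `S` equal to `False` there are no permutation terms, so no action has to be
        -- supplied.
        have α : ∀ c : Cocone F, False → c.pt.ActionData := fun _ h => h.elim
        ⟨⟨colimitCocone (fun c : Cocone F => c) α,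
        { desc := fun c => colimitDesc (fun c : Cocone F => c) α c
          fac := fun _ _ => rfl
          uniq := fun c m hm => colimitDesc_unique (fun c : Cocone F => c) α c m hm
            fun h => h.elim }⟩⟩ }

end Operad

namespace SymmOperad

section Colimits

variable {J : Type u} [Category.{u} J] (F : J ⥤ SymmOperad.{u})

/-- The colimit of a diagram of symmetric operads. -/
noncomputable def colimitSymmOperad : SymmOperad.{u} :=
  (Operad.colimitRaw (S := True) (fun c : Cocone F => forget.mapCocone c)
      (fun c _ => c.pt.act)).toSymmOperad (P := fun c : Cocone F => c.pt)
    (Operad.colimitRep _ _) (Operad.jointlyFaithful_colimitRep _ _)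
    (fun σ ψ => Quotient.mk _ (.act trivial σ ψ.out))
    (fun c _ _ _ _ σ ψ => congrArg (c.pt.act σ) (Operad.eval_out _ _ c ψ))

/-- The colimit cocone of a diagram of symmetric operads. -/
noncomputable def colimitCocone : Cocone F where
  pt := colimitSymmOperad F
  ι :=
    { app := fun j =>
        { toOperadFunctor := Operad.colimitι (S := True)
            (fun c : Cocone F => forget.mapCocone c) (fun c _ => c.pt.act) j
          map_act := fun σ ψ => Quotient.sound fun c =>
            (SymmOperadFunctor.map_act (c.ι.app j) σ ψ).trans
              (congrArg (c.pt.act σ) (Operad.eval_out (S := True)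
                (fun c : Cocone F => forget.mapCocone c) (fun c _ => c.pt.act) c
                (Quotient.mk _ (.of j ψ)))).symm }
      naturality := fun _ _ f => forget_map_injective
        ((Operad.colimitCocone (S := True) (fun c : Cocone F => forget.mapCocone c)
          (fun c _ => c.pt.act)).ι.naturality f) }

/-- The functor of symmetric operads from the colimit given by a cocone. -/
noncomputable def colimitDesc (c : Cocone F) : SymmOperadFunctor (colimitSymmOperad F) c.pt where
  toOperadFunctor := Operad.colimitDesc (S := True)
    (fun c : Cocone F => forget.mapCocone c) (fun c _ => c.pt.act) c
  map_act σ ψ := congrArg (c.pt.act σ) (Operad.eval_out (S := True)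
    (fun c : Cocone F => forget.mapCocone c) (fun c _ => c.pt.act) c ψ)

end Colimits

instance : HasColimits SymmOperad.{u} where
  has_colimits_of_shape _ _ :=
    { has_colimit := fun F => ⟨⟨colimitCocone F,
        { desc := fun c => colimitDesc F c
          fac := fun _ _ => rfl
          uniq := fun c m hm => forget_map_injective
            (Operad.colimitDesc_unique (S := True) (fun c : Cocone F => forget.mapCocone c)
              (fun c _ => c.pt.act) c (SymmOperadFunctor.toOperadFunctor m)
              (fun j => congrArg SymmOperadFunctor.toOperadFunctor (hm j))
              fun h _ _ x y σ t => by
                refine Eq.trans ?_ (SymmOperadFunctor.map_act m (x := x) (y := y) σ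
                  (Quotient.mk _ t))
                refine congrArg (SymmOperadFunctor.toOperadFunctor m).map (Quotient.sound ?_)
                intro d
                exact congrArg (d.pt.act σ) (Operad.eval_out (S := True)
                  (fun c : Cocone F => forget.mapCocone c) (fun c _ => c.pt.act) d
                  (Quotient.mk _ t)).symm) }⟩⟩ }

end SymmOperad

/-! ## Composition with unary morphisms -/

theorem concatSeq_finSigmaFinEquiv {O : Type*} {n : ℕ} {k : Fin n → ℕ} (w : ∀ i, Fin (k i) → O)
    (i : Fin n) (j : Fin (k i)) : concatSeq w (finSigmaFinEquiv ⟨i, j⟩) = w i j :=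
  congrArg (fun t : Σ i, Fin (k i) => w t.1 t.2) (finSigmaFinEquiv.symm_apply_apply ⟨i, j⟩)

theorem cast_eq_finSigmaFinEquiv_one {n : ℕ} (h : n = ∑ _ : Fin 1, n) (i : Fin n) :
    Fin.cast h i = finSigmaFinEquiv (n := fun _ : Fin 1 => n) ⟨0, i⟩ :=
  Fin.ext (by simp)

theorem cast_eq_finSigmaFinEquiv_const_one {n : ℕ} (h : n = ∑ _ : Fin n, 1) (i : Fin n) :
    Fin.cast h i = finSigmaFinEquiv (n := fun _ : Fin n => 1) ⟨i, 0⟩ :=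
  Fin.ext (by simp)

theorem concatSeq_one_cast {O : Type*} {n : ℕ} (h : n = ∑ _ : Fin 1, n) (x : Fin n → O)
    (i : Fin n) : concatSeq (fun _ : Fin 1 => x) (Fin.cast h i) = x i := by
  rw [cast_eq_finSigmaFinEquiv_one, concatSeq_finSigmaFinEquiv]

theorem concatSeq_const_one_cast {O : Type*} {n : ℕ} (h : n = ∑ _ : Fin n, 1) (x : Fin n → O)
    (i : Fin n) : concatSeq (fun i => fun _ : Fin 1 => x i) (Fin.cast h i) = x i := by
  rw [cast_eq_finSigmaFinEquiv_const_one, concatSeq_finSigmaFinEquiv]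

namespace Operad

variable (P : Operad.{u})

/-- The object of the underlying category given by an object of an operad. -/
abbrev under (p : P.Ob) : P.Underlying := ⟨p⟩

/-- Composition of a morphism with a unary morphism out of its output. -/
def post {n : ℕ} {x : Fin n → P.Ob} {y z : P.Ob} (g : P.under y ⟶ P.under z) (ψ : P.Hom x y) :
    P.Hom x z :=
  P.recast (by simp) (fun i => concatSeq_one_cast _ x i)
    (P.comp (x := fun _ : Fin 1 => y) g (fun _ => ψ))

/-- Composition of a morphism with unary morphisms into its inputs. -/
def pre {n : ℕ} {x w : Fin n → P.Ob} {y : P.Ob} (f : ∀ i, P.under (w i) ⟶ P.under (x i))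
    (ψ : P.Hom x y) : P.Hom w y :=
  P.recast (by simp) (fun i => concatSeq_const_one_cast _ w i)
    (P.comp (w := fun i => fun _ : Fin 1 => w i) ψ f)

/-- The family of unary morphisms between concatenated sequences of objects. -/
def concatHom {n : ℕ} {k : Fin n → ℕ} {w v : ∀ i, Fin (k i) → P.Ob}
    (f : ∀ i j, P.under (w i j) ⟶ P.under (v i j)) (a : Fin (∑ i, k i)) :
    P.under (concatSeq w a) ⟶ P.under (concatSeq v a) :=
  f (finSigmaFinEquiv.symm a).1 (finSigmaFinEquiv.symm a).2

section

variable {n : ℕ} {x w v : Fin n → P.Ob} {y z t : P.Ob}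

theorem mk_post (g : P.under y ⟶ P.under z) (ψ : P.Hom x y) :
    (⟨_, _, P.post g ψ⟩ : P.Arr z) =
      ⟨_, _, P.comp (x := fun _ : Fin 1 => y) g (fun _ => ψ)⟩ :=
  P.mk_recast _ _ _

theorem mk_pre (f : ∀ i, P.under (w i) ⟶ P.under (x i)) (ψ : P.Hom x y) :
    (⟨_, _, P.pre f ψ⟩ : P.Arr y) =
      ⟨_, _, P.comp (w := fun i => fun _ : Fin 1 => w i) ψ f⟩ :=
  P.mk_recast _ _ _

theorem post_id (ψ : P.Hom x y) : P.post (𝟙 _) ψ = ψ :=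
  P.eq_of_mk_eq ((P.mk_post _ _).trans (P.id_comp ψ))

theorem pre_id (ψ : P.Hom x y) : P.pre (fun _ => 𝟙 _) ψ = ψ :=
  P.eq_of_mk_eq ((P.mk_pre _ _).trans (P.comp_id ψ))

/-- This lemma, `comp_pre` and `comp_pre_right` are the associativity axiom with the outer, middle
and inner layer unary, respectively. -/
theorem comp_post (g : P.under y ⟶ P.under z) (ψ : P.Hom x y) {k : Fin n → ℕ}
    {w : ∀ i, Fin (k i) → P.Ob} (φ : ∀ i, P.Hom (w i) (x i)) :
    P.comp (P.post g ψ) φ = P.post g (P.comp ψ φ) := by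
  apply P.eq_of_mk_eq
  rw [mk_post]
  refine (P.mk_comp_recast _ _ _ φ (fun a => φ (finSigmaFinEquiv.symm a).2) fun i => ?_).trans
    (P.assoc (x := fun _ : Fin 1 => y) g (fun _ => ψ) fun _ j => φ j)
  rw [cast_eq_finSigmaFinEquiv_one]
  exact congr_arg_heq (fun j => (⟨_, _, φ j⟩ : P.Arr (x j)))
    (congrArg Sigma.snd (finSigmaFinEquiv.symm_apply_apply
      (⟨0, i⟩ : Σ _ : Fin 1, Fin n)) : _)

theorem comp_pre (f : ∀ i, P.under (v i) ⟶ P.under (x i)) (ψ : P.Hom x y) {k : Fin n → ℕ}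
    {w : ∀ i, Fin (k i) → P.Ob} (φ : ∀ i, P.Hom (w i) (v i)) :
    P.comp (P.pre f ψ) φ = P.comp ψ (fun i => P.post (f i) (φ i)) := by
  apply P.eq_of_mk_eq
  refine (P.mk_comp_recast _ _ _ φ (fun a => φ (finSigmaFinEquiv.symm a).1) fun i => ?_).trans
    ((P.assoc (w := fun i => fun _ : Fin 1 => v i) ψ f fun i _ => φ i).trans
    (P.mk_comp_congr _ _ _ fun i => (P.mk_post _ _).symm))
  rw [cast_eq_finSigmaFinEquiv_const_one]
  exact congr_arg_heq (fun j => (⟨_, _, φ j⟩ : P.Arr (v j)))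
    (congrArg Sigma.fst (finSigmaFinEquiv.symm_apply_apply
      (⟨i, 0⟩ : Σ _ : Fin n, Fin 1)) : _)

theorem comp_pre_right (ψ : P.Hom x y) {k : Fin n → ℕ} {w v : ∀ i, Fin (k i) → P.Ob}
    (f : ∀ i j, P.under (w i j) ⟶ P.under (v i j)) (φ : ∀ i, P.Hom (v i) (x i)) :
    P.comp ψ (fun i => P.pre (f i) (φ i)) = P.pre (P.concatHom f) (P.comp ψ φ) := by
  apply P.eq_of_mk_eq
  rw [mk_pre]
  refine (P.mk_comp_congr _ _ _ fun i => P.mk_pre _ _).trans ?_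
  exact (P.assoc (v := fun i j => fun _ : Fin 1 => w i j) ψ φ f).symm

theorem pre_pre (f : ∀ i, P.under (v i) ⟶ P.under (w i)) (g : ∀ i, P.under (w i) ⟶ P.under (x i))
    (ψ : P.Hom x y) : P.pre f (P.pre g ψ) = P.pre (fun i => f i ≫ g i) ψ := by
  apply P.eq_of_mk_eq
  rw [mk_pre, mk_pre]
  exact congrArg (fun t => (⟨_, _, t⟩ : P.Arr y))
    (P.comp_pre g ψ (w := fun i => fun _ : Fin 1 => v i) f)

theorem post_post (f : P.under y ⟶ P.under z) (g : P.under z ⟶ P.under t) (ψ : P.Hom x y) :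
    P.post g (P.post f ψ) = P.post (f ≫ g) ψ := by
  apply P.eq_of_mk_eq
  rw [mk_post, mk_post]
  exact (congrArg (fun t' => (⟨_, _, t'⟩ : P.Arr t))
    (P.comp_pre (x := fun _ : Fin 1 => z) (fun _ => f) g (fun _ => ψ))).symm

theorem pre_post (g : P.under y ⟶ P.under z) (f : ∀ i, P.under (w i) ⟶ P.under (x i))
    (ψ : P.Hom x y) : P.pre f (P.post g ψ) = P.post g (P.pre f ψ) := by
  apply P.eq_of_mk_eq
  rw [mk_pre]
  refine (congrArg (fun t => (⟨_, _, t⟩ : P.Arr z))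
    (P.comp_post g ψ (w := fun i => fun _ : Fin 1 => w i) f)).trans ?_
  rw [mk_post, mk_post]
  exact P.mk_comp_congr _ _ _ fun i => (P.mk_pre _ _).symm

/-- Composition with unary morphisms. -/
def conj (f : ∀ i, P.under (w i) ⟶ P.under (x i)) (g : P.under y ⟶ P.under z) (ψ : P.Hom x y) :
    P.Hom w z :=
  P.post g (P.pre f ψ)

theorem conj_id (ψ : P.Hom x y) : P.conj (fun _ => 𝟙 _) (𝟙 _) ψ = ψ :=
  (P.post_id _).trans (P.pre_id _)

theorem conj_conj (f : ∀ i, P.under (w i) ⟶ P.under (x i)) (g : P.under y ⟶ P.under z)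
    (f' : ∀ i, P.under (v i) ⟶ P.under (w i)) (g' : P.under z ⟶ P.under t) (ψ : P.Hom x y) :
    P.conj f' g' (P.conj f g ψ) = P.conj (fun i => f' i ≫ f i) (g ≫ g') ψ := by
  rw [conj, conj, conj, pre_post, post_post, pre_pre]

/-- Composition in the underlying category is the same recast composite that defines `pre` and
`post`. -/
theorem conj_unary {a b c d : P.Ob} (f : P.under a ⟶ P.under b) (g : P.under c ⟶ P.under d)
    (ψ : P.under b ⟶ P.under c) :
    P.conj (x := fun _ : Fin 1 => b) (w := fun _ : Fin 1 => a) (fun _ => f) g ψ = (f ≫ ψ) ≫ g :=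
  rfl

/-- The unary morphisms meeting at the intermediate objects cancel by `hf`, leaving those at the
outer inputs and the output. This makes `OperadFunctor.lift` compatible with composition. -/
theorem comp_conj (f : ∀ i, P.under (v i) ⟶ P.under (x i)) (g : P.under y ⟶ P.under z)
    (h : ∀ i, P.under (x i) ⟶ P.under (v i)) (hf : ∀ i, h i ≫ f i = 𝟙 _)
    (ψ : P.Hom x y) {k : Fin n → ℕ} {w w' : ∀ i, Fin (k i) → P.Ob}
    (e : ∀ i j, P.under (w' i j) ⟶ P.under (w i j)) (φ : ∀ i, P.Hom (w i) (x i)) :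
    P.comp (P.conj f g ψ) (fun i => P.conj (e i) (h i) (φ i)) =
      P.conj (P.concatHom e) g (P.comp ψ φ) := by
  rw [conj, comp_post, comp_pre, conj, ← comp_pre_right]
  simp only [conj, post_post, hf, post_id]

/-- The bridge between the two ways of handling equal objects: transport by `eqToHom` is invisible
to `toMor`. -/
theorem conj_eqToHom {x' : Fin n → P.Ob} {y' : P.Ob} (hx : ∀ i, P.under (x' i) = P.under (x i))
    (hy : P.under y = P.under y') (ψ : P.Hom x y) :
    P.toMor (P.conj (fun i => eqToHom (hx i)) (eqToHom hy) ψ) = P.toMor ψ := by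
  obtain rfl : x' = x := funext fun i => congrArg Underlying.ob (hx i)
  obtain rfl : y = y' := congrArg Underlying.ob hy
  simp only [eqToHom_refl, conj_id]

theorem toMor_conj_of_eq_eqToHom {f : ∀ i, P.under (w i) ⟶ P.under (x i)}
    {g : P.under y ⟶ P.under z} (hf : ∀ i, ∃ h, f i = eqToHom h) (hg : ∃ h, g = eqToHom h)
    (ψ : P.Hom x y) : P.toMor (P.conj f g ψ) = P.toMor ψ := by
  choose h hf using hf
  obtain ⟨h', rfl⟩ := hg
  obtain rfl : f = fun i => eqToHom (h i) := funext hf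
  exact P.conj_eqToHom h h' ψ

theorem eq_conj_of_toMor_eq {x' : Fin n → P.Ob} {y' : P.Ob}
    (hx : ∀ i, P.under (x' i) = P.under (x i)) (hy : P.under y = P.under y') {ψ : P.Hom x y}
    {ψ' : P.Hom x' y'} (h : P.toMor ψ' = P.toMor ψ) :
    ψ' = P.conj (fun i => eqToHom (hx i)) (eqToHom hy) ψ :=
  P.eq_of_toMor_eq (h.trans (P.conj_eqToHom hx hy ψ).symm)

/-- Composition with isomorphisms is bijective. -/
theorem bijective_conj (f : ∀ i, P.under (w i) ≅ P.under (x i)) (g : P.under y ≅ P.under z) :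
    Function.Bijective (P.conj (fun i => (f i).hom) g.hom) := by
  refine Function.bijective_iff_has_inverse.2 ⟨P.conj (fun i => (f i).inv) g.inv,
    fun ψ => ?_, fun ψ => ?_⟩ <;> simp [conj_conj, conj_id]

end

end Operad

/-! ### Permutations and composition with unary morphisms -/

namespace SymmOperad

variable (P : SymmOperad.{u})

theorem mk_act_recast {l m n m' : ℕ} {x : Fin m → P.Ob} {x' : Fin n → P.Ob} {y : P.Ob}
    (h : n = m) (hx : ∀ i, x (Fin.cast h i) = x' i) (ψ : P.Hom x y) (σ : Fin l ≃ Fin n)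
    (σ' : Fin m' ≃ Fin m) (h' : l = m') (hσ : ∀ i, Fin.cast h (σ i) = σ' (Fin.cast h' i)) :
    (⟨_, _, P.act σ (P.recast h hx ψ)⟩ : P.Arr y) = ⟨_, _, P.act σ' ψ⟩ := by
  subst h h'
  obtain rfl : x = x' := funext hx
  obtain rfl : σ = σ' := Equiv.ext hσ
  rfl

/-- The axiom `comp_act` with all inner permutations trivial: on blocks of length one the block
permutation is `σ` up to reindexing. For `act_post` the outer permutation is trivial and there is a
single block. -/
theorem act_pre {m n : ℕ} {x w : Fin n → P.Ob} {y : P.Ob} (σ : Fin m ≃ Fin n)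
    (f : ∀ i, P.under (w i) ⟶ P.under (x i)) (ψ : P.Hom x y) :
    P.act σ (P.pre f ψ) = P.pre (fun i => f (σ i)) (P.act σ ψ) := by
  apply P.eq_of_mk_eq
  rw [P.mk_pre]
  have h := P.comp_act (w := fun i => fun _ : Fin 1 => w i) σ (fun _ => Equiv.refl (Fin 1)) ψ f
  simp only [P.act_refl] at h
  refine Eq.trans ?_ h.symm
  refine P.mk_act_recast _ _ _ _ _ (by simp) fun i => ?_
  rw [cast_eq_finSigmaFinEquiv_const_one, cast_eq_finSigmaFinEquiv_const_one]
  simp [blockPerm, Equiv.sigmaCongr]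

theorem act_post {m n : ℕ} {x : Fin n → P.Ob} {y z : P.Ob} (σ : Fin m ≃ Fin n)
    (g : P.under y ⟶ P.under z) (ψ : P.Hom x y) :
    P.act σ (P.post g ψ) = P.post g (P.act σ ψ) := by
  apply P.eq_of_mk_eq
  rw [P.mk_post]
  have h := P.comp_act (x := fun _ : Fin 1 => y) (Equiv.refl (Fin 1)) (fun _ => σ) g (fun _ => ψ)
  simp only [P.act_refl] at h
  refine Eq.trans ?_ h.symm
  refine P.mk_act_recast _ _ _ _ _ (by simp) fun i => ?_
  rw [cast_eq_finSigmaFinEquiv_one, cast_eq_finSigmaFinEquiv_one]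
  simp [blockPerm, Equiv.sigmaCongr]

theorem act_conj {m n : ℕ} {x w : Fin n → P.Ob} {y z : P.Ob} (σ : Fin m ≃ Fin n)
    (f : ∀ i, P.under (w i) ⟶ P.under (x i)) (g : P.under y ⟶ P.under z) (ψ : P.Hom x y) :
    P.act σ (P.conj f g ψ) = P.conj (fun i => f (σ i)) g (P.act σ ψ) :=
  (P.act_post σ g _).trans (congrArg (P.post g) (P.act_pre σ f ψ))

end SymmOperad

namespace OperadFunctor

variable {P Q : Operad.{u}} (F : OperadFunctor P Q)

/-- The action of a functor between operads on unary morphisms. -/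
def mapU {a b : P.Ob} (f : P.under a ⟶ P.under b) : Q.under (F.obj a) ⟶ Q.under (F.obj b) :=
  F.underlying.map f

/-- The action of a functor between operads on isomorphisms. -/
def mapIsoU {a b : P.Ob} (f : P.under a ≅ P.under b) : Q.under (F.obj a) ≅ Q.under (F.obj b) :=
  F.underlying.mapIso f

@[simp]
theorem mapU_id (a : P.Ob) : F.mapU (𝟙 (P.under a)) = 𝟙 _ := F.underlying.map_id _

@[simp]
theorem mapU_eqToHom {a b : P.Ob} (h : P.under a = P.under b) :
    F.mapU (eqToHom h) = eqToHom (congrArg F.underlying.obj h) := eqToHom_map F.underlying h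

theorem map_pre {n : ℕ} {x w : Fin n → P.Ob} {y : P.Ob} (f : ∀ i, P.under (w i) ⟶ P.under (x i))
    (ψ : P.Hom x y) : F.map (P.pre f ψ) =
      Q.pre (x := F.obj ∘ x) (w := F.obj ∘ w) (fun i => F.mapU (f i)) (F.map ψ) := by
  refine (F.map_recast _ _ _).trans ?_
  rw [F.map_comp]
  rfl

theorem map_post {n : ℕ} {x : Fin n → P.Ob} {y z : P.Ob} (g : P.under y ⟶ P.under z)
    (ψ : P.Hom x y) : F.map (P.post g ψ) = Q.post (F.mapU g) (F.map ψ) := by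
  refine (F.map_recast _ _ _).trans ?_
  rw [F.map_comp]
  rfl

theorem map_conj {n : ℕ} {x w : Fin n → P.Ob} {y z : P.Ob}
    (f : ∀ i, P.under (w i) ⟶ P.under (x i)) (g : P.under y ⟶ P.under z) (ψ : P.Hom x y) :
    F.map (P.conj f g ψ) =
      Q.conj (x := F.obj ∘ x) (w := F.obj ∘ w) (fun i => F.mapU (f i)) (F.mapU g) (F.map ψ) :=
  (F.map_post _ _).trans (congrArg (Q.post (F.mapU g)) (F.map_pre f ψ))

end OperadFunctor

/-- After substituting the equalities, `he` says that `e` and `f` have the same underlying morphism,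
and both claims are cancellations. They serve the inputs and the output, respectively, in
`exists_lift_of_isEquivalence`. -/
theorem comp_eqToHom_of_iso {C : Type*} [Category C] {a a' b b' : C} (e : a ≅ a') (f : b ≅ b')
    (h : a = b) (h' : a' = b') (he : e.hom ≫ eqToHom h' = eqToHom h ≫ f.hom) :
    (e.inv ≫ eqToHom h) ≫ f.hom = eqToHom h' ∧
      (f.inv ≫ eqToHom h.symm) ≫ e.hom = eqToHom h'.symm := by
  subst h h'
  simp only [eqToHom_refl, Category.comp_id, Category.id_comp] at he ⊢
  exact ⟨by rw [← he, e.inv_hom_id], by rw [he, f.inv_hom_id]⟩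

/-! ## Fully faithful functors and operadic equivalences -/

namespace OperadFunctor

variable {P Q R : Operad.{u}}

/-- A functor between operads that is bijective on all sets of morphisms. -/
def FullyFaithful (F : OperadFunctor P Q) : Prop :=
  ∀ ⦃n : ℕ⦄ (x : Fin n → P.Ob) (y : P.Ob),
    Function.Bijective (F.map : P.Hom x y → Q.Hom (F.obj ∘ x) (F.obj y))

theorem FullyFaithful.exists_iso {F : OperadFunctor P Q} (hF : F.FullyFaithful) {a b : P.Ob}
    (e : Q.under (F.obj a) ≅ Q.under (F.obj b)) :
    ∃ e' : P.under a ≅ P.under b, F.mapU e'.hom = e.hom := by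
  have : F.underlying.Full := ⟨fun f => (hF (fun _ : Fin 1 => _) _).2 f⟩
  have : F.underlying.Faithful := ⟨fun h => (hF (fun _ : Fin 1 => _) _).1 h⟩
  exact ⟨F.underlying.preimageIso e, F.underlying.map_preimage e.hom⟩

theorem isEquivalence_iff {F : OperadFunctor P Q} :
    F.IsEquivalence ↔
      (∀ q, ∃ p, Nonempty (Q.under (F.obj p) ≅ Q.under q)) ∧ F.FullyFaithful := by
  constructor
  · rintro ⟨⟨h⟩, h'⟩
    exact ⟨fun q => let ⟨p, e⟩ := h ⟨q⟩; ⟨p.ob, e⟩, fun n x y => h' x y⟩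
  · rintro ⟨h, h'⟩
    exact ⟨⟨fun q => let ⟨p, e⟩ := h q.ob; ⟨⟨p⟩, e⟩⟩, fun x y => h' x y⟩

/-- Essential surjectivity moves inputs and output into the image of `F`, and fullness supplies the
preimage. Properties stable under conjugation can thus be checked on the image of `F`. -/
theorem IsEquivalence.exists_eq_conj {F : OperadFunctor P Q} (hF : F.IsEquivalence) {n : ℕ}
    {x : Fin n → Q.Ob} {y : Q.Ob} (ψ : Q.Hom x y) :
    ∃ (a : Fin n → P.Ob) (b : P.Ob) (φ : P.Hom a b)
      (f : ∀ i, Q.under (x i) ⟶ Q.under (F.obj (a i))) (g : Q.under (F.obj b) ⟶ Q.under y),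
      Q.conj (x := F.obj ∘ a) f g (F.map φ) = ψ := by
  obtain ⟨h, hff⟩ := isEquivalence_iff.1 hF
  choose o e using h
  let e' (q : Q.Ob) : Q.under (F.obj (o q)) ≅ Q.under q := (e q).some
  obtain ⟨φ, hφ⟩ := (hff (o ∘ x) (o y)).2
    (Q.conj (w := F.obj ∘ o ∘ x) (fun i => (e' (x i)).hom) (e' y).inv ψ)
  refine ⟨o ∘ x, o y, φ, fun i => (e' (x i)).inv, (e' y).hom, ?_⟩
  rw [hφ]
  refine (Q.conj_conj (w := F.obj ∘ o ∘ x) _ _ _ _ ψ).trans ?_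
  simp [Q.conj_id]

theorem IsEquivalence.comp {F : OperadFunctor P Q} {G : OperadFunctor Q R}
    (hF : F.IsEquivalence) (hG : G.IsEquivalence) : (F.comp G).IsEquivalence := by
  rw [isEquivalence_iff] at *
  refine ⟨fun r => ?_, fun n x y => (hG.2 _ _).comp (hF.2 x y)⟩
  obtain ⟨q, ⟨e⟩⟩ := hG.1 r
  obtain ⟨p, ⟨e'⟩⟩ := hF.1 q
  exact ⟨p, ⟨G.mapIsoU e' ≪≫ e⟩⟩

/-- Essential surjectivity of `F` holds because the fully faithful `G` reflects an isomorphism `G (F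
p) ≅ G q`. -/
theorem IsEquivalence.of_comp_right {F : OperadFunctor P Q} {G : OperadFunctor Q R}
    (hG : G.IsEquivalence) (hFG : (F.comp G).IsEquivalence) : F.IsEquivalence := by
  rw [isEquivalence_iff] at *
  refine ⟨fun q => ?_, fun n x y =>
    ((hG.2 (F.obj ∘ x) (F.obj y)).of_comp_iff' _).1 (hFG.2 x y)⟩
  obtain ⟨p, ⟨e⟩⟩ := hFG.1 (G.obj q)
  obtain ⟨e', -⟩ := hG.2.exists_iso (a := F.obj p) (b := q) e
  exact ⟨p, ⟨e'⟩⟩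

/-- On objects in the image of `F`, bijectivity of `G` follows by cancelling that of `F`. Any other
hom-set is carried to such a one by conjugation with isomorphisms, which is bijective and commutes
with `G`. -/
theorem IsEquivalence.of_comp_left {F : OperadFunctor P Q} {G : OperadFunctor Q R}
    (hF : F.IsEquivalence) (hFG : (F.comp G).IsEquivalence) : G.IsEquivalence := by
  rw [isEquivalence_iff] at *
  refine ⟨fun r => let ⟨p, e⟩ := hFG.1 r; ⟨F.obj p, e⟩, fun n x y => ?_⟩
  choose o e using hF.1
  let e' (q : Q.Ob) : Q.under (F.obj (o q)) ≅ Q.under q := (e q).some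
  have h1 := Q.bijective_conj (x := x) (w := F.obj ∘ o ∘ x) (fun i => e' (x i)) (e' y).symm
  have h2 := R.bijective_conj (x := G.obj ∘ x) (w := G.obj ∘ F.obj ∘ o ∘ x)
    (fun i => G.mapIsoU (e' (x i))) (G.mapIsoU (e' y).symm)
  have h3 : Function.Bijective
      (G.map : Q.Hom (F.obj ∘ o ∘ x) (F.obj (o y)) → R.Hom _ _) :=
    (Function.Bijective.of_comp_iff _ (hF.2 (o ∘ x) (o y))).1 (hFG.2 (o ∘ x) (o y))
  refine ((h2.of_comp_iff' (G.map : Q.Hom x y → _))).1 ?_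
  have : (R.conj (x := G.obj ∘ x) (w := G.obj ∘ F.obj ∘ o ∘ x)
      (fun i => (G.mapIsoU (e' (x i))).hom) (G.mapIsoU (e' y).symm).hom) ∘
        (G.map : Q.Hom x y → _) = (G.map : Q.Hom (F.obj ∘ o ∘ x) (F.obj (o y)) → _) ∘
        Q.conj (x := x) (w := F.obj ∘ o ∘ x) (fun i => (e' (x i)).hom) (e' y).symm.hom :=
    funext fun ψ => (G.map_conj (w := F.obj ∘ o ∘ x) _ _ ψ).symm
  rw [this]
  exact h3.comp h1

theorem map_eq_conj {F G : OperadFunctor P Q} (h : F = G) {n : ℕ} {x : Fin n → P.Ob} {y : P.Ob}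
    (ψ : P.Hom x y) : F.map ψ =
      Q.conj (w := F.obj ∘ x) (x := G.obj ∘ x)
        (fun i => eqToHom (congrArg (fun K => Q.under (OperadFunctor.obj K (x i))) h))
        (eqToHom (congrArg (fun K => Q.under (OperadFunctor.obj K y)) h.symm)) (G.map ψ) :=
  Q.eq_conj_of_toMor_eq (x := G.obj ∘ x) (x' := F.obj ∘ x) _ _ (toMor_congr h ψ)

theorem FullyFaithful.toMor_eq {F : OperadFunctor P Q} (hF : F.FullyFaithful) {n : ℕ}
    {x x' : Fin n → P.Ob} {y y' : P.Ob} {ψ : P.Hom x y} {ψ' : P.Hom x' y'}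
    (hx : ∀ i, x i = x' i) (hy : y = y') (h : Q.toMor (F.map ψ) = Q.toMor (F.map ψ')) :
    P.toMor ψ = P.toMor ψ' := by
  subst hy
  obtain rfl : x = x' := funext hx
  obtain rfl : ψ = ψ' := (hF x y).1 (Q.eq_of_toMor_eq h)
  rfl

/-- An isomorphism `G p ≅ i' q` gives `F (r p) = r' (G p) ≅ r' (i' q) = q`. A preimage of `θ` under
`F` is `r η`, where `G η` is `i' θ`; the equalities of objects are absorbed by `eqToHom`. -/
theorem IsEquivalence.of_retract {P' Q' : Operad.{u}} {F : OperadFunctor P Q}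
    {G : OperadFunctor P' Q'} (hG : G.IsEquivalence) {i : OperadFunctor P P'}
    {r : OperadFunctor P' P} {i' : OperadFunctor Q Q'} {r' : OperadFunctor Q' Q}
    (hr : i.comp r = OperadFunctor.id P) (hr' : i'.comp r' = OperadFunctor.id Q)
    (hi : i.comp G = F.comp i') (hF : r.comp F = G.comp r') : F.IsEquivalence := by
  rw [isEquivalence_iff] at *
  have hobj (p : P.Ob) : r.obj (i.obj p) = p := congrArg (fun K => OperadFunctor.obj K p) hr
  have hobj' (q : Q.Ob) : r'.obj (i'.obj q) = q := congrArg (fun K => OperadFunctor.obj K q) hr'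
  have hiobj (p : P.Ob) : G.obj (i.obj p) = i'.obj (F.obj p) :=
    congrArg (fun K => OperadFunctor.obj K p) hi
  have hFobj (p : P'.Ob) : F.obj (r.obj p) = r'.obj (G.obj p) :=
    congrArg (fun K => OperadFunctor.obj K p) hF
  refine ⟨fun q => ?_, fun n x y => ⟨fun ψ φ h => ?_, fun θ => ?_⟩⟩
  · obtain ⟨p, ⟨e⟩⟩ := hG.1 (i'.obj q)
    exact ⟨r.obj p, ⟨eqToIso (congrArg Q.under (hFobj p)) ≪≫ r'.mapIsoU e ≪≫
      eqToIso (congrArg Q.under (hobj' q))⟩⟩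
  · have h1 : G.map (i.map ψ) = G.map (i.map φ) := Q'.eq_of_toMor_eq
      ((toMor_congr hi ψ).trans ((congrArg (fun t => Q'.toMor (i'.map t)) h).trans
        (toMor_congr hi φ).symm))
    have h2 : i.map ψ = i.map φ := (hG.2 _ _).1 h1
    exact P.eq_of_toMor_eq ((toMor_congr hr ψ).symm.trans
      ((congrArg (fun t => P.toMor (r.map t)) h2).trans (toMor_congr hr φ)))
  · obtain ⟨η, hη⟩ := (hG.2 (i.obj ∘ x) (i.obj y)).2
      (Q'.conj (x := i'.obj ∘ F.obj ∘ x) (w := G.obj ∘ i.obj ∘ x)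
        (fun a => eqToHom (congrArg Q'.under (hiobj (x a))))
        (eqToHom (congrArg Q'.under (hiobj y).symm)) (i'.map θ))
    refine ⟨P.conj (x := r.obj ∘ i.obj ∘ x) (w := x)
      (fun a => eqToHom (congrArg P.under (hobj (x a)).symm))
      (eqToHom (congrArg P.under (hobj y))) (r.map η), ?_⟩
    apply Q.eq_of_toMor_eq
    refine (F.toMor_map_congr (P.conj_eqToHom (x := r.obj ∘ i.obj ∘ x) _ _ _)).trans ?_
    refine (toMor_congr hF η).trans ?_
    refine Eq.trans ?_ (toMor_congr hr' θ)
    refine r'.toMor_map_congr ?_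
    rw [hη]
    exact Q'.conj_eqToHom (x := i'.obj ∘ F.obj ∘ x) _ _ _

/-! ## Lifting functors along fully faithful functors -/

section Lift

variable {F : OperadFunctor P Q} (hF : F.FullyFaithful) (G : OperadFunctor R Q)
  (o : R.Ob → P.Ob) (α : ∀ c, Q.under (G.obj c) ≅ Q.under (F.obj (o c)))

/-- The lift of a morphism along a fully faithful functor. -/
noncomputable def liftMap {n : ℕ} {x : Fin n → R.Ob} {y : R.Ob} (ψ : R.Hom x y) :
    P.Hom (o ∘ x) (o y) :=
  ((hF (o ∘ x) (o y)).2 (Q.conj (x := G.obj ∘ x) (w := F.obj ∘ o ∘ x)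
    (fun i => (α (x i)).inv) (α y).hom (G.map ψ))).choose

theorem map_liftMap {n : ℕ} {x : Fin n → R.Ob} {y : R.Ob} (ψ : R.Hom x y) :
    F.map (liftMap hF G o α ψ) = Q.conj (x := G.obj ∘ x) (w := F.obj ∘ o ∘ x)
      (fun i => (α (x i)).inv) (α y).hom (G.map ψ) :=
  ((hF (o ∘ x) (o y)).2 _).choose_spec

/-- The lift of a functor `G` along a fully faithful functor `F`, determined by a family of
isomorphisms between the values of `G` and values of `F`. -/
noncomputable def lift : OperadFunctor R P where
  obj := o
  map := liftMap hF G o α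
  map_id p := (hF (fun _ : Fin 1 => o p) (o p)).1 (by
    refine (map_liftMap hF G o α (R.id p)).trans ?_
    rw [G.map_id, F.map_id]
    refine (Q.conj_unary (α p).inv (α p).hom (𝟙 _)).trans ?_
    rw [Category.comp_id, Iso.inv_hom_id]
    rfl)
  map_comp {n x y k w} ψ φ := (hF _ _).1 (by
    refine (map_liftMap hF G o α (R.comp ψ φ)).trans ?_
    rw [G.map_comp]
    refine Eq.trans ?_ (F.map_comp (x := o ∘ x) (y := o y) (w := fun a => o ∘ w a)
      (liftMap hF G o α ψ) (fun i => liftMap hF G o α (φ i))).symm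
    refine Eq.trans ?_ (congr (congrArg (fun t => Q.comp (x := F.obj ∘ o ∘ x)
      (w := fun a => F.obj ∘ o ∘ w a) t) (map_liftMap hF G o α ψ))
      (funext fun i => map_liftMap hF G o α (φ i))).symm
    exact (Q.comp_conj (x := G.obj ∘ x) (v := F.obj ∘ o ∘ x) _ _ (fun i => (α (x i)).hom)
      (fun i => (α (x i)).hom_inv_id) (G.map ψ) (w := fun a => G.obj ∘ w a)
      (w' := fun a => F.obj ∘ o ∘ w a) (fun i j => (α (w i j)).inv)
      (fun i => G.map (φ i))).symm)

end Lift

/-- With the identity in place of `F`, `lift` conjugates a functor by a family of isomorphisms of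
its values. -/
theorem fullyFaithful_id (P : Operad.{u}) : (OperadFunctor.id P).FullyFaithful :=
  fun _ _ _ => Function.bijective_id

/-! ## Equivariance -/

section Equivariance

variable {A B C : SymmOperad.{u}}

theorem IsEquivariant.of_comp_right {F : OperadFunctor A.toOperad B.toOperad}
    {G : OperadFunctor B.toOperad C.toOperad} {K : OperadFunctor A.toOperad C.toOperad}
    (hG : G.IsEquivariant) (hff : G.FullyFaithful) (hK : F.comp G = K) (h : K.IsEquivariant) :
    F.IsEquivariant := fun {_ _ x y} σ ψ => by
  subst hK
  exact (hff (F.obj ∘ x ∘ σ) (F.obj y)).1 ((h σ ψ).trans (hG σ (F.map ψ)).symm)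

/-- Every morphism of `B` is a conjugate of some `F φ`, where equivariance is known, and conjugation
commutes with permutations and with `G`. -/
theorem IsEquivariant.of_comp_left {F : OperadFunctor A.toOperad B.toOperad}
    {G : OperadFunctor B.toOperad C.toOperad} {K : OperadFunctor A.toOperad C.toOperad}
    (hF : F.IsEquivariant) (hF' : F.IsEquivalence) (hK : F.comp G = K) (h : K.IsEquivariant) :
    G.IsEquivariant := by
  subst hK
  intro m n x y σ ψ
  obtain ⟨a, b, φ, f, g, rfl⟩ := hF'.exists_eq_conj ψ
  have h1 := B.act_conj (x := F.obj ∘ a) σ f g (F.map φ)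
  rw [← hF σ φ] at h1
  refine (congrArg G.map h1).trans ?_
  refine (G.map_conj (x := F.obj ∘ a ∘ σ) (w := x ∘ σ) _ _ _).trans ?_
  refine Eq.trans ?_ (congrArg (C.act σ) (G.map_conj (x := F.obj ∘ a) f g (F.map φ))).symm
  refine Eq.trans ?_ (C.act_conj (x := G.obj ∘ F.obj ∘ a) (w := G.obj ∘ x) σ _ _ _).symm
  exact congrArg (C.conj (x := G.obj ∘ F.obj ∘ a ∘ σ) (w := G.obj ∘ x ∘ σ) _ _) (h σ φ)

end Equivariance

/-! ## The lifting axioms -/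

section Lifting

variable {A B X Y : Operad.{u}} {i : OperadFunctor A B} {p : OperadFunctor X Y}
  {s : OperadFunctor A X} {t : OperadFunctor B Y}

theorem exists_lift_of_surjective (hi : Function.Injective i.obj)
    (hp : Function.Surjective p.obj) (hff : p.FullyFaithful) (h : s.comp p = i.comp t) :
    ∃ l : OperadFunctor B X, i.comp l = s ∧ l.comp p = t := by
  classical
  have hobj (a : A.Ob) : p.obj (s.obj a) = t.obj (i.obj a) :=
    congrArg (fun K => OperadFunctor.obj K a) h
  -- On the image of `i` the value is forced by `s`, consistently since `i` is injective on objects;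
  -- elsewhere any preimage under `p` will do.
  have (b : B.Ob) : ∃ x : X.Ob, t.obj b = p.obj x ∧ ∀ a, i.obj a = b → x = s.obj a := by
    by_cases hb : ∃ a, i.obj a = b
    · obtain ⟨a, rfl⟩ := hb
      exact ⟨s.obj a, (hobj a).symm, fun a' ha' => by rw [hi ha']⟩
    · obtain ⟨x, hx⟩ := hp (t.obj b)
      exact ⟨x, hx.symm, fun a ha => (hb ⟨a, ha⟩).elim⟩
  choose o ho hoi using this
  let l := lift hff t o (fun b => eqToIso (congrArg Y.under (ho b)))
  have hl {n : ℕ} {x : Fin n → B.Ob} {y : B.Ob} (ψ : B.Hom x y) :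
      Y.toMor (p.map (l.map ψ)) = Y.toMor (t.map ψ) := by
    refine (congrArg Y.toMor (map_liftMap hff t o (fun b => eqToIso (congrArg Y.under (ho b))) ψ)).trans ?_
    exact Y.toMor_conj_of_eq_eqToHom (x := t.obj ∘ x) 
      (fun _ => ⟨congrArg Y.under (ho _).symm, rfl⟩) ⟨congrArg Y.under (ho _), rfl⟩ _
  refine ⟨l, ext_toMor (fun a => hoi _ a rfl) fun {n x y} ψ => ?_,
    ext_toMor (fun b => (ho b).symm) hl⟩
  have h1 : Y.toMor (p.map (l.map (i.map ψ))) = Y.toMor (p.map (s.map ψ)) :=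
    (hl (i.map ψ)).trans (toMor_congr h ψ).symm
  exact hff.toMor_eq (fun a => hoi _ _ rfl) (hoi _ _ rfl) h1

theorem exists_lift_of_isEquivalence (hi : Function.Injective i.obj) (hi' : i.IsEquivalence)
    (hp : p.IsIsofibration) (h : s.comp p = i.comp t) :
    ∃ l : OperadFunctor B X, i.comp l = s ∧ l.comp p = t := by
  classical
  obtain ⟨hes, hff⟩ := isEquivalence_iff.1 hi'
  have hobj (a : A.Ob) : p.obj (s.obj a) = t.obj (i.obj a) :=
    congrArg (fun K => OperadFunctor.obj K a) h
  -- Taking `β` to be an identity on the image of `i` makes the triangle over `A` commute strictly,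
  -- not just up to isomorphism.
  have (b : B.Ob) : ∃ (a : A.Ob) (β : B.under (i.obj a) ≅ B.under b),
      ∀ a', i.obj a' = b → a = a' ∧ ∃ h, β = eqToIso h := by
    by_cases hb : ∃ a, i.obj a = b
    · obtain ⟨a, rfl⟩ := hb
      exact ⟨a, Iso.refl _, fun a' ha' => ⟨(hi ha').symm, rfl, rfl⟩⟩
    · obtain ⟨a, ⟨e⟩⟩ := hes b
      exact ⟨a, e, fun a ha => (hb ⟨a, ha⟩).elim⟩
  choose r β hβ using this
  have hr (a : A.Ob) : r (i.obj a) = a := (hβ _ a rfl).1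
  -- The isofibration `p` lifts `t (β b)` to an isomorphism out of `s (r b)`; on the image of `i`
  -- the lift is again chosen to be an identity.
  have (b : B.Ob) : ∃ (x : X.Ob) (φ : X.under (s.obj (r b)) ≅ X.under x)
      (e : Y.under (p.obj x) = Y.under (t.obj b)),
      p.mapU φ.hom ≫ eqToHom e = eqToHom (congrArg Y.under (hobj (r b))) ≫ t.mapU (β b).hom ∧
      ∀ a', i.obj a' = b → ∃ h, φ = eqToIso h := by
    by_cases hb : ∃ a, i.obj a = b
    · obtain ⟨a, rfl⟩ := hb
      obtain ⟨e, he⟩ := (hβ _ a rfl).2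
      refine ⟨s.obj (r (i.obj a)), Iso.refl _, ?_, ?_, fun _ _ => ⟨rfl, rfl⟩⟩
      · rw [hr, hobj]
      · rw [he]
        rw [Iso.refl_hom, mapU_id, Category.id_comp]
        exact ((congrArg (_ ≫ ·) (t.mapU_eqToHom e)).trans (eqToHom_trans _ _)).symm
    · obtain ⟨⟨x⟩, φ, e, he⟩ := hp ⟨s.obj (r b)⟩ ⟨t.obj b⟩
        (eqToIso (congrArg Y.under (hobj (r b))) ≪≫ t.mapIsoU (β b))
      exact ⟨x, φ, e, he, fun a ha => (hb ⟨a, ha⟩).elim⟩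
  choose o φ e he hφ using this
  let ρ := lift hff (OperadFunctor.id B) r (fun b => (β b).symm)
  let l := lift (fullyFaithful_id X) (ρ.comp s) o φ
  have hρ {n : ℕ} {x : Fin n → B.Ob} {y : B.Ob} (ψ : B.Hom x y) :
      i.map (ρ.map ψ) =
        B.conj (w := i.obj ∘ r ∘ x) (fun a => (β (x a)).hom) (β y).inv ψ :=
    map_liftMap hff (OperadFunctor.id B) r (fun b => (β b).symm) ψ
  have hl {n : ℕ} {x : Fin n → B.Ob} {y : B.Ob} (ψ : B.Hom x y) :
      l.map ψ = X.conj (x := s.obj ∘ r ∘ x) (w := o ∘ x)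
        (fun a => (φ (x a)).inv) (φ y).hom (s.map (ρ.map ψ)) :=
    map_liftMap (fullyFaithful_id X) (ρ.comp s) o φ ψ
  have hio (a : A.Ob) : o (i.obj a) = s.obj a := by
    obtain ⟨h', -⟩ := hφ _ a rfl
    exact (congrArg Operad.Underlying.ob h').symm.trans (congrArg s.obj (hr a))
  refine ⟨l, ext_toMor hio fun {n x y} ψ => ?_,
    ext_toMor (fun b => congrArg Operad.Underlying.ob (e b)) fun {n x y} ψ => ?_⟩
  · have h1 : A.toMor (ρ.map (i.map ψ)) = A.toMor ψ := by
      refine hff.toMor_eq (fun a => hr _) (hr _) ?_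
      rw [hρ]
      refine B.toMor_conj_of_eq_eqToHom (x := i.obj ∘ x) (fun a => ?_) ?_ _
      · obtain ⟨h', h''⟩ := (hβ _ (x a) rfl).2
        exact ⟨h', congrArg Iso.hom h''⟩
      · obtain ⟨h', h''⟩ := (hβ _ y rfl).2
        exact ⟨h'.symm, congrArg Iso.inv h''⟩
    refine Eq.trans ?_ (s.toMor_map_congr h1)
    refine (congrArg X.toMor (hl (i.map ψ))).trans ?_
    refine X.toMor_conj_of_eq_eqToHom (x := s.obj ∘ r ∘ i.obj ∘ x) (fun a => ?_) ?_ _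
    · obtain ⟨h', h''⟩ := hφ _ (x a) rfl
      exact ⟨h'.symm, congrArg Iso.inv h''⟩
    · obtain ⟨h', h''⟩ := hφ _ y rfl
      exact ⟨h', congrArg Iso.hom h''⟩
  · have h1 : p.map (s.map (ρ.map ψ)) = _ := map_eq_conj h (ρ.map ψ)
    have h2 : t.map (i.map (ρ.map ψ)) =
        Y.conj (x := t.obj ∘ x) (w := t.obj ∘ i.obj ∘ r ∘ x)
          (fun a => t.mapU (β (x a)).hom) (t.mapU (β y).inv) (t.map ψ) :=
      (congrArg t.map (hρ ψ)).trans (t.map_conj (w := i.obj ∘ r ∘ x) _ _ ψ)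
    have h3 : p.map (l.map ψ) = _ :=
      (congrArg p.map (hl ψ)).trans (p.map_conj (x := s.obj ∘ r ∘ x) (w := o ∘ x) _ _ _)
    -- The image of the lift is `t ψ` conjugated successively by `t β`, by equalities of objects and
    -- by `p φ`. Since `p φ` lifts `t β`, everything collapses to `eqToHom`.
    have h4 : p.map (l.map ψ) = Y.conj (x := p.obj ∘ s.obj ∘ r ∘ x) (w := p.obj ∘ o ∘ x)
        (fun a => p.mapU (φ (x a)).inv) (p.mapU (φ y).hom)
        (Y.conj (x := t.obj ∘ i.obj ∘ r ∘ x) (w := p.obj ∘ s.obj ∘ r ∘ x)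
          (fun a => eqToHom (congrArg Y.under (hobj (r (x a)))))
          (eqToHom (congrArg Y.under (hobj (r y)).symm))
          (Y.conj (x := t.obj ∘ x) (w := t.obj ∘ i.obj ∘ r ∘ x)
            (fun a => t.mapU (β (x a)).hom) (t.mapU (β y).inv) (t.map ψ))) :=
      h3.trans (congrArg (Y.conj (x := p.obj ∘ s.obj ∘ r ∘ x) (w := p.obj ∘ o ∘ x) _ _)
        (h1.trans (congrArg (Y.conj (x := t.obj ∘ i.obj ∘ r ∘ x) (w := p.obj ∘ s.obj ∘ r ∘ x) _ _)
          h2)))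
    refine (congrArg Y.toMor h4).trans ?_
    rw [Y.conj_conj, Y.conj_conj]
    refine Y.toMor_conj_of_eq_eqToHom (x := t.obj ∘ x) (fun a => ⟨e (x a), ?_⟩) ⟨(e y).symm, ?_⟩ _
    · exact (comp_eqToHom_of_iso (p.mapIsoU (φ (x a))) (t.mapIsoU (β (x a))) _ _ (he (x a))).1
    · exact (Category.assoc _ _ _).symm.trans (comp_eqToHom_of_iso (p.mapIsoU (φ y)) (t.mapIsoU (β y)) _ _ (he y)).2

end Lifting

end OperadFunctor

/-! ## Isofibrations -/

/-- A retract of an isofibration of categories is an isofibration. -/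
theorem isofibration_of_retract {C D C' D' : Type*} [Category C] [Category D] [Category C']
    [Category D'] {F : C ⥤ D} {G : C' ⥤ D'} {i : C ⥤ C'} {r : C' ⥤ C} {i' : D ⥤ D'} {r' : D' ⥤ D}
    (hr : i ⋙ r = 𝟭 C) (hr' : i' ⋙ r' = 𝟭 D) (hi : i ⋙ G = F ⋙ i') (hF : r ⋙ F = G ⋙ r')
    (hG : ∀ (c : C') (d : D') (ψ : G.obj c ≅ d), ∃ (c' : C') (φ : c ≅ c') (h : G.obj c' = d),
      G.map φ.hom ≫ eqToHom h = ψ.hom) (c : C) (d : D) (ψ : F.obj c ≅ d) :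
    ∃ (c' : C) (φ : c ≅ c') (h : F.obj c' = d), F.map φ.hom ≫ eqToHom h = ψ.hom := by
  obtain ⟨c', φ, h, hφ⟩ := hG (i.obj c) (i'.obj d)
    (eqToIso (Functor.congr_obj hi c) ≪≫ i'.mapIso ψ)
  refine ⟨r.obj c', eqToIso (Functor.congr_obj hr c).symm ≪≫ r.mapIso φ,
    (Functor.congr_obj hF c').trans ((congrArg r'.obj h).trans (Functor.congr_obj hr' d)), ?_⟩
  have h1 : F.map (r.map φ.hom) = _ := Functor.congr_hom hF φ.hom
  have h2 : G.map φ.hom = (eqToHom (Functor.congr_obj hi c) ≫ i'.map ψ.hom) ≫ eqToHom h.symm := by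
    have h3 : (eqToHom (Functor.congr_obj hi c) ≫ i'.map ψ.hom) = _ := hφ.symm
    rw [h3]
    simp
  have h3 : r'.map (i'.map ψ.hom) = _ := Functor.congr_hom hr' ψ.hom
  simp [h1, h2, h3, eqToHom_map]

namespace OperadFunctor

/-- Essential surjectivity gives `F p ≅ q`; lifting this isomorphism yields an object lying strictly
over `q`. -/
theorem IsIsofibration.surjective {P Q : Operad.{u}} {F : OperadFunctor P Q}
    (hF : F.IsIsofibration) (hF' : F.IsEquivalence) : Function.Surjective F.obj := by
  intro q
  obtain ⟨p, ⟨e⟩⟩ := (isEquivalence_iff.1 hF').1 q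
  obtain ⟨p', -, h, -⟩ := hF ⟨p⟩ ⟨q⟩ e
  exact ⟨p'.ob, congrArg Operad.Underlying.ob h⟩

end OperadFunctor

/-! ## Factorizations -/

namespace Operad

section

variable (Q : Operad.{u}) {A : Type u} (o : A → Q.Ob)

/-- The data of the operad obtained by pulling back an operad along a map of sets of objects. -/
def pullbackRaw : RawOperad.{u} where
  Ob := A
  Hom x y := Q.Hom (o ∘ x) (o y)
  id p := Q.id (o p)
  comp {_ _ _ _ w} ψ φ := Q.comp (w := fun i => o ∘ w i) ψ φ

/-- The representation of the pulled back data in the original operad. -/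
def pullbackRep : (Q.pullbackRaw o).Rep Q where
  obj := o
  map ψ := ψ
  map_id _ := rfl
  map_comp _ _ := rfl

theorem jointlyFaithful_pullbackRep :
    RawOperad.JointlyFaithful fun _ : Unit => Q.pullbackRep o :=
  fun _ _ _ _ _ h => h ()

/-- The operad obtained by pulling back an operad along a map of sets of objects. -/
def pullback : Operad.{u} :=
  (Q.pullbackRaw o).toOperad (fun _ : Unit => Q.pullbackRep o) (Q.jointlyFaithful_pullbackRep o)

/-- The functor from the pulled back operad to the original one. -/
def pullbackProj : OperadFunctor (Q.pullback o) Q :=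
  (Q.pullbackRaw o).toOperadFunctor (fun _ : Unit => Q.pullbackRep o)
    (Q.jointlyFaithful_pullbackRep o) ()

theorem fullyFaithful_pullbackProj : (Q.pullbackProj o).FullyFaithful :=
  fun _ _ _ => Function.bijective_id

end

end Operad

/-- The symmetric operad obtained by pulling back a symmetric operad along a map of sets of
objects. -/
def SymmOperad.pullback (Q : SymmOperad.{u}) {A : Type u} (o : A → Q.Ob) : SymmOperad.{u} :=
  (Q.toOperad.pullbackRaw o).toSymmOperad (P := fun _ : Unit => Q)
    (fun _ => Q.toOperad.pullbackRep o) (Q.toOperad.jointlyFaithful_pullbackRep o)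
    (fun {_ _ x _} σ ψ => Q.act (x := o ∘ x) σ ψ) (fun _ _ _ _ _ _ _ => rfl)

namespace OperadFunctor

variable {P Q : Operad.{u}} (F : OperadFunctor P Q)

/-- The intermediate operad in the factorization of a functor into a functor that is injective on
objects followed by an isofibration that is an equivalence. -/
abbrev mappingCylinder : Operad.{u} := Q.pullback (Sum.elim F.obj fun q : Q.Ob => q)

/-- The functor to the mapping cylinder. -/
def toMappingCylinder : OperadFunctor P F.mappingCylinder where
  obj := Sum.inl
  map ψ := F.map ψ
  map_id := F.map_id
  map_comp ψ φ := F.map_comp ψ φ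

/-- The functor from the mapping cylinder. -/
abbrev fromMappingCylinder : OperadFunctor F.mappingCylinder Q := Q.pullbackProj _

theorem isEquivalence_fromMappingCylinder : F.fromMappingCylinder.IsEquivalence :=
  isEquivalence_iff.2 ⟨fun q => ⟨Sum.inr q, ⟨Iso.refl _⟩⟩, Q.fullyFaithful_pullbackProj _⟩

/-- The copy `Sum.inr q` lies strictly over `q`, and full faithfulness lifts the isomorphism to one
ending there. -/
theorem isIsofibration_fromMappingCylinder : F.fromMappingCylinder.IsIsofibration := by
  rintro ⟨e⟩ ⟨q⟩ ψ
  obtain ⟨φ, hφ⟩ := (Q.fullyFaithful_pullbackProj _).exists_iso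
    (F := F.fromMappingCylinder) (a := e) (b := Sum.inr q) ψ
  exact ⟨⟨Sum.inr q⟩, φ, rfl, (Category.comp_id _).trans hφ⟩

/-- The objects of the mapping path operad. -/
abbrev MappingPathOb : Type u := Σ (p : P.Ob) (q : Q.Ob), Q.under (F.obj p) ≅ Q.under q

/-- The intermediate operad in the factorization of a functor into an equivalence that is
injective on objects followed by an isofibration. -/
abbrev mappingPath : Operad.{u} := P.pullback (A := F.MappingPathOb) Sigma.fst

/-- The functor to the mapping path operad. -/
def toMappingPath : OperadFunctor P F.mappingPath where
  obj p := ⟨p, F.obj p, Iso.refl _⟩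
  map ψ := ψ
  map_id _ := rfl
  map_comp _ _ := rfl

theorem injective_toMappingPath : Function.Injective F.toMappingPath.obj :=
  fun _ _ h => congrArg Sigma.fst h

/-- Morphisms of the mapping path operad see only the first component, so the identity of `p` is an
isomorphism between any two triples over `p`. -/
theorem isEquivalence_toMappingPath : F.toMappingPath.IsEquivalence := by
  refine isEquivalence_iff.2 ⟨fun e => ⟨e.1, ?_⟩, fun _ _ _ => Function.bijective_id⟩
  obtain ⟨φ, -⟩ := (P.fullyFaithful_pullbackProj Sigma.fst).exists_iso
    (a := F.toMappingPath.obj e.1) (b := e) (Iso.refl (P.under e.1))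
  exact ⟨φ⟩

/-- The functor from the mapping path operad. -/
noncomputable def fromMappingPath : OperadFunctor F.mappingPath Q :=
  lift (fullyFaithful_id Q) ((P.pullbackProj Sigma.fst).comp F) (fun e => e.2.1) fun e => e.2.2

theorem fromMappingPath_map {n : ℕ} {x : Fin n → F.mappingPath.Ob} {y : F.mappingPath.Ob}
    (ψ : F.mappingPath.Hom x y) : F.fromMappingPath.map ψ =
      Q.conj (x := fun i => F.obj (x i).1) (fun i => (x i).2.2.inv) y.2.2.hom
        (F.map ((P.pullbackProj Sigma.fst).map ψ)) :=
  map_liftMap (fullyFaithful_id Q) ((P.pullbackProj Sigma.fst).comp F) _ _ ψ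

theorem toMappingPath_comp : F.toMappingPath.comp F.fromMappingPath = F := by
  refine ext_toMor (fun _ => rfl) fun {n x y} ψ => ?_
  refine (congrArg Q.toMor (F.fromMappingPath_map (F.toMappingPath.map ψ))).trans ?_
  exact Q.toMor_conj_of_eq_eqToHom (x := F.obj ∘ x) (w := F.obj ∘ x)
    (fun _ => ⟨rfl, rfl⟩) ⟨rfl, rfl⟩ _

/-- The lift is the identity of `p`, regarded as a morphism from `(p, q, α)` to `(p, q', α ≪≫ ψ)`;
its image is `α⁻¹` followed by `α` and `ψ`. -/
theorem isIsofibration_fromMappingPath : F.fromMappingPath.IsIsofibration := by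
  rintro ⟨⟨p, q, α⟩⟩ ⟨q'⟩ ψ
  obtain ⟨φ, hφ⟩ := (P.fullyFaithful_pullbackProj Sigma.fst).exists_iso
    (a := (⟨p, q, α⟩ : F.MappingPathOb)) (b := ⟨p, q', α ≪≫ ψ⟩) (Iso.refl (P.under p))
  refine ⟨⟨⟨p, q', α ≪≫ ψ⟩⟩, φ, rfl, ?_⟩
  refine (Category.comp_id _).trans ((F.fromMappingPath_map φ.hom).trans ?_)
  refine (congrArg (fun θ => Q.conj (x := fun _ : Fin 1 => F.obj p) (w := fun _ : Fin 1 => q)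
    (fun _ => α.inv) (α ≪≫ ψ).hom (F.mapU θ)) hφ).trans ?_
  refine (Q.conj_unary (c := F.obj p) α.inv (α ≪≫ ψ).hom (F.mapU (𝟙 _))).trans ?_
  rw [mapU_id, Category.comp_id]
  exact α.inv_hom_id_assoc ψ.hom

end OperadFunctor

/-! ## The model structure on operads -/

namespace Operad

instance : opeClasses.{u}.weq.HasTwoOutOfThreeProperty where
  comp_mem _ _ hf hg := OperadFunctor.IsEquivalence.comp hf hg
  of_postcomp _ _ hg hfg := OperadFunctor.IsEquivalence.of_comp_right hg hfg
  of_precomp _ _ hf hfg := OperadFunctor.IsEquivalence.of_comp_left hf hfg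

instance : opeClasses.{u}.weq.IsStableUnderRetracts where
  of_retract h hg := OperadFunctor.IsEquivalence.of_retract hg h.retract_left h.retract_right
    h.i_w h.r_w

instance : rezkClasses.{u}.fib.IsStableUnderRetracts where
  of_retract h hg := isofibration_of_retract
    (congrArg Cat.Hom.toFunctor h.retract_left) (congrArg Cat.Hom.toFunctor h.retract_right)
    (congrArg Cat.Hom.toFunctor h.i_w) (congrArg Cat.Hom.toFunctor h.r_w) hg

/-- Isomorphisms of an operad live in its underlying category, so fibrations are definitionally the
inverse image of the Rezk fibrations under `jStar`. -/
instance : opeClasses.{u}.fib.IsStableUnderRetracts :=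
  inferInstanceAs (rezkClasses.{u}.fib.inverseImage jStar.{u}).IsStableUnderRetracts

instance : opeClasses.{u}.cof.IsStableUnderRetracts where
  of_retract {X Y Z W f g} h hg p p' hp := by
    have h1 (p : X.Ob) : OperadFunctor.obj g (OperadFunctor.obj h.i.left p) =
        OperadFunctor.obj h.i.right (OperadFunctor.obj f p) :=
      congrArg (fun K => OperadFunctor.obj K p) h.i_w
    have h2 (p : X.Ob) : OperadFunctor.obj h.r.left (OperadFunctor.obj h.i.left p) = p :=
      congrArg (fun K => OperadFunctor.obj K p) h.retract_left
    rw [← h2 p, ← h2 p']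
    exact congrArg _ (hg ((h1 p).trans ((congrArg _ hp).trans (h1 p').symm)))

theorem exists_lift {A B X Y : Operad.{u}} {i : A ⟶ B} {p : X ⟶ Y} (hi : opeClasses.cof i)
    (hp : opeClasses.fib p) (hip : opeClasses.weq i ∨ opeClasses.weq p) {s : A ⟶ X} {t : B ⟶ Y}
    (h : s ≫ p = i ≫ t) : ∃ l : B ⟶ X, i ≫ l = s ∧ l ≫ p = t := by
  obtain hip | hip := hip
  · exact OperadFunctor.exists_lift_of_isEquivalence hi hip hp h
  · exact OperadFunctor.exists_lift_of_surjective hi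
      (OperadFunctor.IsIsofibration.surjective hp hip) (OperadFunctor.isEquivalence_iff.1 hip).2 h

theorem isModelStructure : opeClasses.{u}.IsModelStructure where
  hasLimits := inferInstance
  hasColimits := inferInstance
  weq_twoOutOfThree := inferInstance
  weq_retracts := inferInstance
  fib_retracts := inferInstance
  cof_retracts := inferInstance
  lifting _ _ hi hp hip := ⟨fun sq =>
    let ⟨l, h, h'⟩ := exists_lift hi hp hip sq.w
    ⟨⟨⟨l, h, h'⟩⟩⟩⟩
  factorization_cof_trivialFib := ⟨fun F => ⟨
    { Z := OperadFunctor.mappingCylinder F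
      i := OperadFunctor.toMappingCylinder F
      p := OperadFunctor.fromMappingCylinder F
      fac := rfl
      hi := Sum.inl_injective
      hp := ⟨OperadFunctor.isIsofibration_fromMappingCylinder F,
        OperadFunctor.isEquivalence_fromMappingCylinder F⟩ }⟩⟩
  factorization_trivialCof_fib := ⟨fun F => ⟨
    { Z := OperadFunctor.mappingPath F
      i := OperadFunctor.toMappingPath F
      p := OperadFunctor.fromMappingPath F
      fac := OperadFunctor.toMappingPath_comp F
      hi := ⟨OperadFunctor.injective_toMappingPath F,
        OperadFunctor.isEquivalence_toMappingPath F⟩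
      hp := OperadFunctor.isIsofibration_fromMappingPath F }⟩⟩

end Operad

/-! ## The model structure on symmetric operads -/

namespace SymmOperad

instance : opeSymmClasses.{u}.weq.HasTwoOutOfThreeProperty :=
  inferInstanceAs (opeClasses.{u}.weq.inverseImage forget.{u}).HasTwoOutOfThreeProperty

instance : opeSymmClasses.{u}.weq.IsStableUnderRetracts :=
  inferInstanceAs (opeClasses.{u}.weq.inverseImage forget.{u}).IsStableUnderRetracts

instance : opeSymmClasses.{u}.fib.IsStableUnderRetracts :=
  inferInstanceAs (opeClasses.{u}.fib.inverseImage forget.{u}).IsStableUnderRetracts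

instance : opeSymmClasses.{u}.cof.IsStableUnderRetracts :=
  inferInstanceAs (opeClasses.{u}.cof.inverseImage forget.{u}).IsStableUnderRetracts

theorem isEquivariant_map {P Q : SymmOperad.{u}} (F : P ⟶ Q) :
    (SymmOperadFunctor.toOperadFunctor F).IsEquivariant :=
  fun σ ψ => SymmOperadFunctor.map_act F σ ψ

/-- The functor of symmetric operads given by an equivariant functor. -/
def homMk {P Q : SymmOperad.{u}} (F : OperadFunctor P.toOperad Q.toOperad)
    (hF : F.IsEquivariant) : P ⟶ Q :=
  { toOperadFunctor := F
    map_act := hF }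

/-- A lift of the underlying operads is automatically equivariant: cancel `i` if it is the
equivalence, and `p` otherwise. -/
theorem exists_lift {A B X Y : SymmOperad.{u}} {i : A ⟶ B} {p : X ⟶ Y}
    (hi : opeSymmClasses.cof i) (hp : opeSymmClasses.fib p)
    (hip : opeSymmClasses.weq i ∨ opeSymmClasses.weq p) {s : A ⟶ X} {t : B ⟶ Y}
    (h : s ≫ p = i ≫ t) : ∃ l : B ⟶ X, i ≫ l = s ∧ l ≫ p = t := by
  obtain ⟨l, h1, h2⟩ := Operad.exists_lift (i := forget.map i) (p := forget.map p)
    (s := forget.map s) (t := forget.map t) hi hp hip (congrArg forget.map h)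
  have hl : OperadFunctor.IsEquivariant (P := B) (Q := X) l := by
    obtain hip | hip := hip
    · exact OperadFunctor.IsEquivariant.of_comp_left (isEquivariant_map i) hip h1
        (isEquivariant_map s)
    · exact OperadFunctor.IsEquivariant.of_comp_right (isEquivariant_map p)
        (OperadFunctor.isEquivalence_iff.1 hip).2 h2 (isEquivariant_map t)
  exact ⟨homMk l hl, forget_map_injective h1, forget_map_injective h2⟩

theorem isModelStructure : opeSymmClasses.{u}.IsModelStructure where
  hasLimits := inferInstance
  hasColimits := inferInstance
  weq_twoOutOfThree := inferInstance
  weq_retracts := inferInstance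
  fib_retracts := inferInstance
  cof_retracts := inferInstance
  lifting _ _ hi hp hip := ⟨fun sq =>
    let ⟨l, h, h'⟩ := exists_lift hi hp hip sq.w
    ⟨⟨⟨l, h, h'⟩⟩⟩⟩
  factorization_cof_trivialFib := ⟨fun {_ Q} F =>
    let F' := SymmOperadFunctor.toOperadFunctor F
    ⟨{  Z := Q.pullback (Sum.elim F'.obj fun q : Q.Ob => q)
        i := homMk F'.toMappingCylinder (isEquivariant_map F)
        p := homMk F'.fromMappingCylinder fun _ _ => rfl
        fac := rfl
        hi := Sum.inl_injective
        hp := ⟨F'.isIsofibration_fromMappingCylinder, F'.isEquivalence_fromMappingCylinder⟩ }⟩⟩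
  factorization_trivialCof_fib := ⟨fun {P Q} F =>
    let F' := SymmOperadFunctor.toOperadFunctor F
    have h : OperadFunctor.IsEquivariant (Q := P.pullback (A := F'.MappingPathOb) Sigma.fst)
      F'.toMappingPath := fun _ _ => rfl
    ⟨{  Z := P.pullback (A := F'.MappingPathOb) Sigma.fst
        i := homMk F'.toMappingPath h
        -- Equivariance comes from that of `F` by cancelling the equivalence `toMappingPath`, which
        -- avoids computing with the conjugations.
        p := homMk F'.fromMappingPath
          (OperadFunctor.IsEquivariant.of_comp_left (C := Q) h F'.isEquivalence_toMappingPath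
            F'.toMappingPath_comp (isEquivariant_map F))
        fac := forget_map_injective F'.toMappingPath_comp
        hi := ⟨F'.injective_toMappingPath, F'.isEquivalence_toMappingPath⟩
        hp := F'.isIsofibration_fromMappingPath }⟩⟩

end SymmOperad

/-! ## The model structure on categories -/

namespace Operad

section

variable (C : Type u) [Category.{u} C]

/-- The functor from a category to the underlying category of its operad. -/
def toUnderlyingOfCat : C ⥤ (ofCat C).Underlying :=
  OperadFunctor.toUnderlying (OperadFunctor.id (ofCat C))

theorem toUnderlyingOfCat_map_hom {a b : (ofCat C).Underlying} (f : a ⟶ b) :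
    (toUnderlyingOfCat C).map (X := a.ob) (Y := b.ob) (UnaryHom.hom f 0) = f := by
  refine UnaryHom.ext (funext fun j => ?_)
  obtain rfl : j = 0 := Subsingleton.elim _ _
  rfl

/-- The functor to a category from the underlying category of its operad. -/
def fromUnderlyingOfCat : (ofCat C).Underlying ⥤ C where
  obj a := a.ob
  map f := UnaryHom.hom f 0
  map_id _ := rfl
  map_comp {a b c} f g := by
    have h := (toUnderlyingOfCat C).map_comp (X := a.ob) (Y := b.ob) (Z := c.ob)
      (UnaryHom.hom f 0) (UnaryHom.hom g 0)
    rw [toUnderlyingOfCat_map_hom, toUnderlyingOfCat_map_hom] at h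
    exact (congrFun (congrArg UnaryHom.hom h) 0).symm

theorem fromUnderlyingOfCat_comp_to :
    fromUnderlyingOfCat C ⋙ toUnderlyingOfCat C = 𝟭 _ :=
  CategoryTheory.Functor.hext (fun _ => rfl) fun _ _ f =>
    heq_of_eq (toUnderlyingOfCat_map_hom C f)

instance : (toUnderlyingOfCat C).IsEquivalence where
  faithful := ⟨fun h => congrFun (congrArg UnaryHom.hom h) 0⟩
  full := ⟨fun f => ⟨UnaryHom.hom f 0, toUnderlyingOfCat_map_hom C f⟩⟩
  essSurj := ⟨fun a => ⟨a.ob, ⟨Iso.refl _⟩⟩⟩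

instance : (fromUnderlyingOfCat C).IsEquivalence where
  faithful := ⟨fun {a b f g} h => by
    rw [← toUnderlyingOfCat_map_hom C f, ← toUnderlyingOfCat_map_hom C g]
    exact congrArg ((toUnderlyingOfCat C).map (X := a.ob) (Y := b.ob)) h⟩
  full := ⟨fun {a b} f => ⟨(toUnderlyingOfCat C).map (X := a.ob) (Y := b.ob) f, rfl⟩⟩
  essSurj := ⟨fun c => ⟨⟨c⟩, ⟨Iso.refl _⟩⟩⟩

end

end Operad

namespace OperadFunctor

variable {C D : Type u} [Category.{u} C] [Category.{u} D] (F : C ⥤ D)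

/-- A `UnaryHom` is a family of morphisms with its arity condition, so fullness and faithfulness
hold entrywise, including the empty non-unary hom-sets. Conversely, one constant input suffices. -/
theorem isEquivalence_ofFunctor_iff : (ofFunctor F).IsEquivalence ↔ F.IsEquivalence := by
  rw [isEquivalence_iff]
  constructor
  · rintro ⟨h1, h2⟩
    exact
      { essSurj := ⟨fun d => let ⟨c, ⟨e⟩⟩ := h1 d
          ⟨c, ⟨(Operad.fromUnderlyingOfCat D).mapIso e⟩⟩⟩
        full := ⟨fun {a b} f => by
          obtain ⟨g, hg⟩ := (h2 (fun _ : Fin 1 => a) b).2 (⟨rfl, fun _ => f⟩ : UnaryHom _ _)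
          exact ⟨UnaryHom.hom g 0, congrFun (congrArg UnaryHom.hom hg) 0⟩⟩
        faithful := ⟨fun {a b f g} h => by
          have h3 := (h2 (fun _ : Fin 1 => a) b).1
            (a₁ := (⟨rfl, fun _ => f⟩ : UnaryHom _ _))
            (a₂ := (⟨rfl, fun _ => g⟩ : UnaryHom _ _)) (UnaryHom.ext (funext fun _ => h))
          exact congrFun (congrArg UnaryHom.hom h3) 0⟩ }
  · intro h
    refine ⟨fun d => ⟨F.objPreimage d,
      ⟨(Operad.toUnderlyingOfCat D).mapIso (F.objObjPreimageIso d)⟩⟩,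
      fun n x y => ⟨fun f g h => UnaryHom.ext (funext fun i => F.map_injective
        (congrFun (congrArg UnaryHom.hom h) i)), fun g =>
        ⟨(⟨UnaryHom.arity g, fun i => F.preimage (UnaryHom.hom g i)⟩ : UnaryHom _ _),
          UnaryHom.ext (funext fun i => F.map_preimage _)⟩⟩⟩

theorem isIsofibration_ofFunctor
    (hF : ∀ (c : C) (d : D) (ψ : F.obj c ≅ d), ∃ (c' : C) (φ : c ≅ c') (h : F.obj c' = d),
      F.map φ.hom ≫ eqToHom h = ψ.hom) : (ofFunctor F).IsIsofibration := by
  rintro ⟨c⟩ ⟨d⟩ ψ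
  obtain ⟨c', φ, rfl, hφ⟩ := hF c d ((Operad.fromUnderlyingOfCat D).mapIso ψ)
  refine ⟨⟨c'⟩, (Operad.toUnderlyingOfCat C).mapIso φ, rfl, ?_⟩
  refine (Category.comp_id _).trans (UnaryHom.ext (funext fun i => ?_))
  obtain rfl : i = 0 := Subsingleton.elim _ _
  exact (Category.comp_id _).symm.trans hφ

theorem isEquivalence_underlying {P Q : Operad.{u}} {G : OperadFunctor P Q}
    (hG : G.IsEquivalence) : G.underlying.IsEquivalence where
  essSurj := hG.essSurj
  full := ⟨fun f => (hG.fullyFaithful (fun _ : Fin 1 => _) _).2 f⟩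
  faithful := ⟨fun h => (hG.fullyFaithful (fun _ : Fin 1 => _) _).1 h⟩

end OperadFunctor

theorem preservesModelClasses_jShriek :
    PreservesModelClasses rezkClasses.{u} opeClasses.{u} jShriek.{u} where
  map_cof _ hf := hf
  map_fib f hf := OperadFunctor.isIsofibration_ofFunctor f.toFunctor hf
  map_weq f hf := (OperadFunctor.isEquivalence_ofFunctor_iff f.toFunctor).2 hf

theorem preservesModelClasses_jStar :
    PreservesModelClasses opeClasses.{u} rezkClasses.{u} jStar.{u} where
  map_cof _ hf := fun _ _ h => congrArg Operad.Underlying.mk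
    (hf (congrArg Operad.Underlying.ob h))
  map_fib _ hf := hf
  map_weq _ hf := OperadFunctor.isEquivalence_underlying hf

theorem preservesModelClasses_jShriekSymm :
    PreservesModelClasses rezkClasses.{u} opeSymmClasses.{u} jShriekSymm.{u} where
  map_cof := preservesModelClasses_jShriek.map_cof
  map_fib := preservesModelClasses_jShriek.map_fib
  map_weq := preservesModelClasses_jShriek.map_weq

theorem preservesModelClasses_jStarSymm :
    PreservesModelClasses opeSymmClasses.{u} rezkClasses.{u} jStarSymm.{u} where
  map_cof f hf := preservesModelClasses_jStar.map_cof (SymmOperad.forget.map f) hf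
  map_fib f hf := preservesModelClasses_jStar.map_fib (SymmOperad.forget.map f) hf
  map_weq f hf := preservesModelClasses_jStar.map_weq (SymmOperad.forget.map f) hf

/-! ### Transfer of the axioms from operads to categories -/

instance : jShriek.{u}.Faithful where
  map_injective {C D F G} h := by
    apply Cat.Hom.ext
    have h' : OperadFunctor.toUnderlying (OperadFunctor.ofFunctor F.toFunctor) =
      OperadFunctor.toUnderlying (OperadFunctor.ofFunctor G.toFunctor) :=
      congrArg (fun K : OperadFunctor (Operad.ofCat C) (Operad.ofCat D) => K.toUnderlying) h
    exact congrArg (fun K => K ⋙ Operad.fromUnderlyingOfCat D) h'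

instance : jShriek.{u}.Full where
  map_surjective {C D} G := by
    refine ⟨(OperadFunctor.toUnderlying (C := C) (P := Operad.ofCat D) G ⋙
      Operad.fromUnderlyingOfCat D).toCatHom, ?_⟩
    apply (OperadFunctor.underlyingEquiv C (Operad.ofCat D)).injective
    exact congrArg (fun K => OperadFunctor.toUnderlying (C := C) (P := Operad.ofCat D) G ⋙ K)
      (Operad.fromUnderlyingOfCat_comp_to D)

/-- Inverse images under a functor inherit two-out-of-three and stability under retracts. -/
theorem rezkClasses_weq : rezkClasses.{u}.weq = opeClasses.{u}.weq.inverseImage jShriek.{u} := by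
  ext _ _ F
  exact (OperadFunctor.isEquivalence_ofFunctor_iff F.toFunctor).symm

instance : rezkClasses.{u}.weq.HasTwoOutOfThreeProperty := by
  rw [rezkClasses_weq]; infer_instance

instance : rezkClasses.{u}.weq.IsStableUnderRetracts := by
  rw [rezkClasses_weq]; infer_instance

instance : rezkClasses.{u}.cof.IsStableUnderRetracts :=
  inferInstanceAs (opeClasses.{u}.cof.inverseImage jShriek.{u}).IsStableUnderRetracts

/-- The inclusion of a category into the underlying category of its operad. -/
def jUnit (C : Cat.{u, u}) : C ⟶ jStar.obj (jShriek.obj C) :=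
  (Operad.toUnderlyingOfCat C).toCatHom

/-- The functor from the underlying category of the operad of a category to this category. -/
def jUnitInv (C : Cat.{u, u}) : jStar.obj (jShriek.obj C) ⟶ C :=
  (Operad.fromUnderlyingOfCat C).toCatHom

theorem rezkClasses_weq_jUnit (C : Cat.{u, u}) : rezkClasses.weq (jUnit C) :=
  inferInstanceAs (Operad.toUnderlyingOfCat C).IsEquivalence

theorem rezkClasses_weq_jUnitInv (C : Cat.{u, u}) : rezkClasses.weq (jUnitInv C) :=
  inferInstanceAs (Operad.fromUnderlyingOfCat C).IsEquivalence

theorem rezkClasses_cof_comp_jUnit {C : Cat.{u, u}} {D : Cat.{u, u}}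
    {F : jStar.obj (jShriek.obj C) ⟶ D} (hF : rezkClasses.cof F) :
    rezkClasses.cof (jUnit C ≫ F) :=
  fun _ _ h => congrArg Operad.Underlying.ob (hF h)

/-- Since `jUnitInv` is an isomorphism of categories, an isomorphism in `D` is transported back
along it, lifted through `F`, and compared again in `D`. -/
theorem rezkClasses_fib_comp_jUnitInv {C D : Cat.{u, u}} {F : C ⟶ jStar.obj (jShriek.obj D)}
    (hF : rezkClasses.fib F) : rezkClasses.fib (F ≫ jUnitInv D) := by
  intro c d ψ
  obtain ⟨c', φ, h, hφ⟩ := hF c ⟨d⟩ ((Operad.toUnderlyingOfCat D).mapIso ψ)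
  have h' := congrArg (Operad.fromUnderlyingOfCat D).obj h
  refine ⟨c', φ, h', ?_⟩
  have h1 := congrArg (Operad.fromUnderlyingOfCat D).map hφ
  refine Eq.trans ?_ h1
  refine Eq.trans ?_ ((Operad.fromUnderlyingOfCat D).map_comp _ _).symm
  exact congrArg (_ ≫ ·) (eqToHom_map (Operad.fromUnderlyingOfCat D) h).symm

theorem fac_of_fac_jShriek {C D : Cat.{u, u}} (F : C ⟶ D) {P : Operad.{u}}
    {i : jShriek.obj C ⟶ P} {p : P ⟶ jShriek.obj D} (h : i ≫ p = jShriek.map F) :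
    (jUnit C ≫ jStar.map i) ≫ jStar.map p ≫ jUnitInv D = F := by
  rw [Category.assoc, ← jStar.map_comp_assoc, h]
  rfl

theorem isModelStructure_rezkClasses : rezkClasses.{u}.IsModelStructure where
  hasLimits := inferInstance
  hasColimits := inferInstance
  weq_twoOutOfThree := inferInstance
  weq_retracts := inferInstance
  fib_retracts := inferInstance
  cof_retracts := inferInstance
  lifting i p hi hp hip := ⟨fun {s t} sq => by
    obtain ⟨l, h, h'⟩ := Operad.exists_lift (s := jShriek.map s) (t := jShriek.map t)
      (preservesModelClasses_jShriek.map_cof i hi) (preservesModelClasses_jShriek.map_fib p hp)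
      (hip.imp (preservesModelClasses_jShriek.map_weq i)
        (preservesModelClasses_jShriek.map_weq p))
      (by rw [← Functor.map_comp, sq.w, Functor.map_comp])
    -- The lift was found in `Operad`; full faithfulness of `jShriek` brings it and both triangles
    -- back to `Cat`.
    obtain ⟨l, rfl⟩ := jShriek.map_surjective l
    exact ⟨⟨⟨l, jShriek.map_injective ((jShriek.map_comp _ _).trans h),
      jShriek.map_injective ((jShriek.map_comp _ _).trans h')⟩⟩⟩⟩
  factorization_cof_trivialFib := ⟨fun {C D} F => by
    -- The middle operad may have non-unary morphisms; `jStar` discards them and preserves all three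
    -- classes.
    obtain ⟨d⟩ := Operad.isModelStructure.factorization_cof_trivialFib.nonempty_mapFactorizationData
      (jShriek.map F)
    exact ⟨
      { Z := jStar.obj d.Z
        i := jUnit C ≫ jStar.map d.i
        p := jStar.map d.p ≫ jUnitInv D
        fac := fac_of_fac_jShriek F d.fac
        hi := rezkClasses_cof_comp_jUnit (preservesModelClasses_jStar.map_cof _ d.hi)
        hp := ⟨rezkClasses_fib_comp_jUnitInv (preservesModelClasses_jStar.map_fib _ d.hp.1),
          rezkClasses.weq.comp_mem _ _ (preservesModelClasses_jStar.map_weq _ d.hp.2)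
            (rezkClasses_weq_jUnitInv D)⟩ }⟩⟩
  factorization_trivialCof_fib := ⟨fun {C D} F => by
    obtain ⟨d⟩ := Operad.isModelStructure.factorization_trivialCof_fib.nonempty_mapFactorizationData
      (jShriek.map F)
    exact ⟨
      { Z := jStar.obj d.Z
        i := jUnit C ≫ jStar.map d.i
        p := jStar.map d.p ≫ jUnitInv D
        fac := fac_of_fac_jShriek F d.fac
        hi := ⟨rezkClasses_cof_comp_jUnit (preservesModelClasses_jStar.map_cof _ d.hi.1),
          rezkClasses.weq.comp_mem _ _ (rezkClasses_weq_jUnit C)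
            (preservesModelClasses_jStar.map_weq _ d.hi.2)⟩
        hp := rezkClasses_fib_comp_jUnitInv (preservesModelClasses_jStar.map_fib _ d.hp) }⟩⟩

/-! ## The Quillen adjunctions -/

theorem PreservesModelClasses.isQuillenAdjunction {C D : Type*} [Category C] [Category D]
    {M : ModelClasses C} {N : ModelClasses D} {L : C ⥤ D} {R : D ⥤ C} (adj : L ⊣ R)
    (hM : M.IsModelStructure) (hN : N.IsModelStructure) (hL : PreservesModelClasses M N L) :
    IsQuillenAdjunction M N adj where
  isModelStructure_source := hM
  isModelStructure_target := hN
  map_cof := hL.map_cof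
  map_trivialCof f hf := ⟨hL.map_cof f hf.1, hL.map_weq f hf.2⟩

theorem mainTheorem5 :
    (IsQuillenAdjunction rezkClasses.{u} opeClasses.{u} jAdj.{u} ∧
      IsQuillenAdjunction rezkClasses.{u} opeSymmClasses.{u} jAdjSymm.{u}) ∧
    (PreservesModelClasses rezkClasses.{u} opeClasses.{u} jShriek.{u} ∧
      PreservesModelClasses opeClasses.{u} rezkClasses.{u} jStar.{u}) ∧
    (PreservesModelClasses rezkClasses.{u} opeSymmClasses.{u} jShriekSymm.{u} ∧
      PreservesModelClasses opeSymmClasses.{u} rezkClasses.{u} jStarSymm.{u}) :=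
  ⟨⟨preservesModelClasses_jShriek.isQuillenAdjunction _ isModelStructure_rezkClasses
      Operad.isModelStructure,
    preservesModelClasses_jShriekSymm.isQuillenAdjunction _ isModelStructure_rezkClasses
      SymmOperad.isModelStructure⟩,
    ⟨preservesModelClasses_jShriek, preservesModelClasses_jStar⟩,
    ⟨preservesModelClasses_jShriekSymm, preservesModelClasses_jStarSymm⟩⟩
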